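/- Let $\Bbbk$ be a field and let $H$ be a finite-dimensional Hopf algebra over $\Bbbk$ with coproduct $\Delta(h)=h_{(1)}\otimes h_{(2)}$, counit $\varepsilon$ and (automatically bijective) antipode $S$. Let $\hat H$ be its dual Hopf algebra, with product $(\omega\theta)(h)=\omega(h_{(1)})\theta(h_{(2)})$, coproduct $\hat\Delta(\omega)=\omega_{(1)}\otimes\omega_{(2)}$ determined by $\omega(hh')=\omega_{(1)}(h)\,\omega_{(2)}(h')$, counit $\hat\varepsilon(\omega)=\omega(1)$ and antipode $\hat S(\omega)=\omega\circ S$. Put $(h\blacktriangleright\omega)(x)=\omega(xh)$, $(\omega\blacktriangleleft h)(x)=\omega(hx)$ and $h\blacktriangleleft\omega=\omega(h_{(1)})\,h_{(2)}$ for $h,x\in H$, $\omega\in\hat H$. Write $\Sigma$ for the flip of tensor factors and $\mathrm{Ad}(W)(x)=WxW^{-1}$. A right coaction of a Hopf algebra $C$ on an algebra $X$ is an algebra homomorphism $\rho:X\to X\otimes C$ with $(\rho\otimes\mathrm{id})\rho=(\mathrm{id}\otimes\Delta_C)\rho$ and $(\mathrm{id}\otimes\varepsilon_C)\rho=\mathrm{id}$;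 a left action of $C$ on $X$ is a left $C$-module algebra structure on $X$. Let $U=\sum_i h_i\otimes\hat h_i\in H\otimes\hat H$ be the canonical element ($(h_i)$ a basis of $H$, $(\hat h_i)$ the dual basis); it is invertible with $U^{-1}=(S\otimes\mathrm{id})(U)$. Let ${}^{\circ}U=\sum_i h_i^{\mathrm{op}}\otimes\hat h_i\in H^{\mathrm{op}}\otimes\hat H$, which is invertible with inverse $\sum_i S^{-1}(h_i)^{\mathrm{op}}\otimes\hat h_i$. Here $H^{\mathrm{op}}$ is $H$ with the opposite product and the same coproduct. The Heisenberg algebra $\mathcal H(\hat H)=\hat H\#H$ is the vector space $\hat H\otimes H$ with product $(\theta\#h)(\theta'\#h')=\theta(h_{(1)}\blacktriangleright\theta')\#h_{(2)}h'$ and unit $1\#1$; let $\hat\iota_1(\theta)=\theta\#1$ and $\hat\iota_2(h)=1\#h$. Put $$\mathbb V=(\hat\iota_1\otimes\mathrm{id})(\Sigma({}^{\circ}U))\in\mathcal H(\hat H)\otimes H^{\mathrm{op}},\qquad \mathbb U=(\hat\iota_2\otimes\mathrm{id})(U)\in\mathcal H(\hat H)\otimes\hat H,$$ $$\alpha(x)=\mathbb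 V(x\otimes1)\mathbb V^{-1},\qquad \beta(x)=\mathbb U(x\otimes1)\mathbb U^{-1}\qquad(x\in\mathcal H(\hat H)).$$ The Drinfeld codouble $\mathcal T(H)$ is the algebra $H^{\mathrm{op}}\otimes\hat H$ with coproduct $(\mathrm{id}\otimes\Sigma\,\mathrm{Ad}({}^{\circ}U)\otimes\mathrm{id})(\Delta\otimes\hat\Delta)$ and counit $\varepsilon\otimes\hat\varepsilon$. The Drinfeld double $\mathcal D(H)=\hat H^{\mathrm{co}}\bowtie H$ is the vector space $\hat H\otimes H$ with product $(\omega\bowtie a)(\theta\bowtie b)=\omega\,(a_{(1)}\blacktriangleright\theta\blacktriangleleft S^{-1}(a_{(3)}))\bowtie a_{(2)}b$, unit $1\bowtie1$, coproduct $\omega\bowtie a\mapsto(\omega_{(2)}\bowtie a_{(1)})\otimes(\omega_{(1)}\bowtie a_{(2)})$ and counit $\omega\bowtie a\mapsto\omega(1)\varepsilon(a)$. They are paired by $\mathbf p_{\mathcal D}(\omega\bowtie h,\,c^{\mathrm{op}}\otimes\theta)=\omega(c)\,\theta(h)$. Then: (1) $(\mathcal H(\hat H),\alpha,\beta)$ is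 a right-right $(H,\hat H)$-Yetter–Drinfeld algebra, that is, $\alpha$ is a right coaction of $H^{\mathrm{op}}$ on $\mathcal H(\hat H)$, $\beta$ is a right coaction of $\hat H$ on $\mathcal H(\hat H)$, and $$(\alpha\otimes\mathrm{id})\beta=(\mathrm{id}\otimes\mathrm{Ad}({}^{\circ}U)^{-1})(\mathrm{id}\otimes\Sigma)(\beta\otimes\mathrm{id})\alpha.$$ (2) $\Gamma=(\alpha\otimes\mathrm{id})\beta:\mathcal H(\hat H)\to\mathcal H(\hat H)\otimes\mathcal T(H)$ is a right coaction of $\mathcal T(H)$ on $\mathcal H(\hat H)$. (3) The induced map $d\rhd_\Gamma x=(\mathrm{id}\otimes\mathbf p_{\mathcal D}(d,\cdot))(\Gamma(x))$ is a left action of $\mathcal D(H)$ on $\mathcal H(\hat H)$, and for all $\omega,\theta\in\hat H$ and $h,g\in H$, $$(\omega\bowtie h)\rhd_\Gamma(\theta\#g)=\omega_{(3)}\,(h_{(1)}\blacktriangleright\theta)\,\hat S^{-1}(\omega_{(2)})\;\#\;\bigl((h_{(2)}\,g\,S(h_{(3)}))\blacktriangleleft\hat S^{-1}(\omega_{(1)})\bigr).$$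 -/

import Mathlib

open scoped TensorProduct
open Coalgebra HopfAlgebra

set_option linter.unusedSectionVars false

namespace HeisenbergYD

noncomputable section

section Dual
variable (k H : Type*) [Field k] [Ring H] [HopfAlgebra k H]

/-- The dual `Ĥ` of `H`, with Mathlib's convolution algebra structure on `H →ₗ[k] k`:
`(ω * θ)(h) = ω(h₍₁₎) θ(h₍₂₎)`, with unit `ε`. -/
def HopfDual : Type _ := WithConv (H →ₗ[k] k)

instance HopfDual.ring : Ring (HopfDual k H) := inferInstanceAs (Ring (WithConv (H →ₗ[k] k)))

instance HopfDual.algebra : Algebra k (HopfDual k H) :=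
  inferInstanceAs (Algebra k (WithConv (H →ₗ[k] k)))

/-- The identity map from `Ĥ` to linear functionals on `H`. -/
def HopfDual.equiv : HopfDual k H ≃ₗ[k] Module.Dual k H where
  toFun ω := WithConv.ofConv ω
  invFun f := WithConv.toConv f
  map_add' _ _ := rfl
  map_smul' _ _ := rfl
  left_inv _ := rfl
  right_inv _ := rfl

/-- The canonical pairing `p(h, ω) = ω(h)`. -/
def pairing : H →ₗ[k] HopfDual k H →ₗ[k] k := (HopfDual.equiv k H).toLinearMap.flip

variable {k H}

theorem HopfDual.ext {ω θ : HopfDual k H} (h : ∀ x, pairing k H x ω = pairing k H x θ) : ω = θ :=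
  (HopfDual.equiv k H).injective (LinearMap.ext h)

@[simp] theorem pairing_symm (x : H) (f : Module.Dual k H) :
    pairing k H x ((HopfDual.equiv k H).symm f) = f x := rfl

theorem pairing_mul {ι : Type*} {h : H} (r : Coalgebra.Repr k h ι) (ω θ : HopfDual k H) :
    pairing k H h (ω * θ) =
      ∑ i ∈ r.index, pairing k H (r.left i) ω * pairing k H (r.right i) θ :=
  r.convMul_apply _ _

@[simp] theorem pairing_one (h : H) : pairing k H h (1 : HopfDual k H) = counit (R := k) h := rfl

/-- The left regular action of `H` on `Ĥ`: `(h ▶ ω)(x) = ω(x h)`, that is `ω₍₁₎ p(h, ω₍₂₎)`. -/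
def regL : H →ₗ[k] HopfDual k H →ₗ[k] HopfDual k H :=
  LinearMap.mk₂ k
    (fun h ω => (HopfDual.equiv k H).symm (HopfDual.equiv k H ω ∘ₗ LinearMap.mulRight k h))
    (fun a b c => by rw [← map_add]; congr 1; ext x; simp [mul_add])
    (fun a b c => by rw [← map_smul]; congr 1; ext x; simp)
    (fun a b c => by rw [← map_add]; congr 1)
    (fun a b c => by rw [← map_smul]; congr 1)

/-- The right regular action of `H` on `Ĥ`: `(ω ◀ h)(x) = ω(h x)`, that is `p(h, ω₍₁₎) ω₍₂₎`. -/
def regR : HopfDual k H →ₗ[k] H →ₗ[k] HopfDual k H :=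
  LinearMap.mk₂ k
    (fun ω h => (HopfDual.equiv k H).symm (HopfDual.equiv k H ω ∘ₗ LinearMap.mulLeft k h))
    (fun a b c => by rw [← map_add]; congr 1)
    (fun a b c => by rw [← map_smul]; congr 1)
    (fun a b c => by rw [← map_add]; congr 1; ext x; simp [add_mul])
    (fun a b c => by rw [← map_smul]; congr 1; ext x; simp)

@[simp] theorem pairing_regL (h x : H) (ω : HopfDual k H) :
    pairing k H x (regL h ω) = pairing k H (x * h) ω := rfl
@[simp] theorem pairing_regR (h x : H) (ω : HopfDual k H) :
    pairing k H x (regR ω h) = pairing k H (h * x) ω := rfl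

variable {A : Type*} [AddCommGroup A] [Module k A]

/-- The map `p(h, ·) ⊗ id : Ĥ ⊗ A → A`. -/
def evL (h : H) : HopfDual k H ⊗[k] A →ₗ[k] A :=
  (TensorProduct.lid k A).toLinearMap ∘ₗ (pairing k H h).rTensor A

/-- The map `id ⊗ p(h, ·) : A ⊗ Ĥ → A`. -/
def evR (h : H) : A ⊗[k] HopfDual k H →ₗ[k] A :=
  (TensorProduct.rid k A).toLinearMap ∘ₗ (pairing k H h).lTensor A

@[simp] theorem evL_tmul (h : H) (ω : HopfDual k H) (a : A) :
    evL h (ω ⊗ₜ[k] a) = pairing k H h ω • a := rfl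
@[simp] theorem evR_tmul (h : H) (ω : HopfDual k H) (a : A) :
    evR h (a ⊗ₜ[k] ω) = pairing k H h ω • a := rfl

theorem evL_lTensor {B : Type*} [AddCommGroup B] [Module k B] (f : A →ₗ[k] B) (h : H)
    (t : HopfDual k H ⊗[k] A) : evL h (f.lTensor _ t) = f (evL h t) := by
  induction t with
  | zero => simp
  | add z w hz hw => simp only [map_add, hz, hw]
  | tmul z w => simp

theorem evR_rTensor {B : Type*} [AddCommGroup B] [Module k B] (f : A →ₗ[k] B) (h : H)
    (t : A ⊗[k] HopfDual k H) : evR h (f.rTensor _ t) = f (evR h t) := by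
  induction t with
  | zero => simp
  | add z w hz hw => simp only [map_add, hz, hw]
  | tmul z w => simp

section Mul
variable {B : Type*} [Ring B] [Algebra k B]

theorem evL_mul (x y : HopfDual k H ⊗[k] B) {ι : Type*} {h : H} (r : Coalgebra.Repr k h ι) :
    evL h (x * y) = ∑ i ∈ r.index, evL (r.left i) x * evL (r.right i) y := by
  induction x with
  | zero => simp
  | add x x' hx hx' => simp only [add_mul, map_add, hx, hx', Finset.sum_add_distrib]
  | tmul a b =>
    induction y with
    | zero => simp
    | add x x' hx hx' => simp only [mul_add, map_add, hx, hx', Finset.sum_add_distrib]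
    | tmul c d =>
      simp [Algebra.TensorProduct.tmul_mul_tmul, pairing_mul r, Finset.sum_smul, smul_smul, mul_comm]

theorem evR_mul (x y : B ⊗[k] HopfDual k H) {ι : Type*} {h : H} (r : Coalgebra.Repr k h ι) :
    evR h (x * y) = ∑ i ∈ r.index, evR (r.left i) x * evR (r.right i) y := by
  induction x with
  | zero => simp
  | add x x' hx hx' => simp only [add_mul, map_add, hx, hx', Finset.sum_add_distrib]
  | tmul a b =>
    induction y with
    | zero => simp
    | add x x' hx hx' => simp only [mul_add, map_add, hx, hx', Finset.sum_add_distrib]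
    | tmul c d =>
      simp [Algebra.TensorProduct.tmul_mul_tmul, pairing_mul r, Finset.sum_smul, smul_smul, mul_comm]

end Mul

theorem pairing_evR (h x : H) (t : HopfDual k H ⊗[k] HopfDual k H) :
    pairing k H x (evR h t) = pairing k H h (evL x t) := by
  induction t with
  | zero => simp
  | add z w hz hw => simp only [map_add, hz, hw]
  | tmul z w => simp [mul_comm]

theorem regR_mul {ι : Type*} {h : H} (r : Coalgebra.Repr k h ι) (ω θ : HopfDual k H) :
    regR (ω * θ) h = ∑ i ∈ r.index, regR ω (r.left i) * regR θ (r.right i) := by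
  apply HopfDual.ext
  intro y
  rw [pairing_regR, pairing_mul (r.mul (ℛ k y)), map_sum]
  simp only [pairing_mul (ℛ k y)]
  simp [Coalgebra.Repr.mul, Finset.sum_product]

theorem regL_mul {ι : Type*} {h : H} (r : Coalgebra.Repr k h ι) (ω θ : HopfDual k H) :
    regL h (ω * θ) = ∑ i ∈ r.index, regL (r.left i) ω * regL (r.right i) θ := by
  apply HopfDual.ext
  intro y
  rw [pairing_regL, pairing_mul ((ℛ k y).mul r), map_sum]
  simp only [pairing_mul (ℛ k y)]
  simp [Coalgebra.Repr.mul, Finset.sum_product]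
  rw [Finset.sum_comm]

theorem pairing_one_mul (ω θ : HopfDual k H) :
    pairing k H 1 (ω * θ) = pairing k H 1 ω * pairing k H 1 θ := by
  refine (pairing_mul (⟨{()}, fun _ => 1, fun _ => 1, by simp [Algebra.TensorProduct.one_def]⟩ :
    Coalgebra.Repr k (1 : H) Unit) ω θ).trans (by simp)

variable [FiniteDimensional k H]

instance HopfDual.finite : FiniteDimensional k (HopfDual k H) :=
  Module.Finite.equiv (HopfDual.equiv k H).symm

theorem evL_ext {x y : HopfDual k H ⊗[k] A} (h : ∀ a, evL a x = evL a y) : x = y := by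
  let e : HopfDual k H ⊗[k] A ≃ₗ[k] (H →ₗ[k] A) :=
    (TensorProduct.congr (HopfDual.equiv k H) (LinearEquiv.refl k A)).trans
      (dualTensorHomEquiv k H A)
  have he : ∀ z a, e z a = evL a z := by
    intro z a
    induction z with
    | zero => simp
    | add z w hz hw => simp only [map_add, LinearMap.add_apply, hz, hw]
    | tmul z w => simp [e, dualTensorHom_apply]; rfl
  apply e.injective
  ext a
  rw [he, he, h]

theorem evR_ext {x y : A ⊗[k] HopfDual k H} (h : ∀ a, evR a x = evR a y) : x = y := by
  have he : ∀ (z : A ⊗[k] HopfDual k H) (a : H), evL a (TensorProduct.comm k _ _ z) = evR a z := by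
    intro z a
    induction z with
    | zero => simp
    | add z w hz hw => simp only [map_add, hz, hw]
    | tmul z w => simp
  apply (TensorProduct.comm k _ _).injective
  exact evL_ext fun a => by rw [he, he, h]

/-- The comultiplication of `Ĥ` is the transpose of the multiplication of `H`, and its counit is
`ω ↦ ω(1)`. -/
instance HopfDual.coalgebraStruct : CoalgebraStruct k (HopfDual k H) where
  comul := TensorProduct.map (HopfDual.equiv k H).symm.toLinearMap
      (HopfDual.equiv k H).symm.toLinearMap ∘ₗ
    (TensorProduct.dualDistribEquiv k H H).symm.toLinearMap ∘ₗ
    (LinearMap.mul' k H).dualMap ∘ₗ (HopfDual.equiv k H).toLinearMap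
  counit := pairing k H 1

@[simp] theorem HopfDual.counit_apply (ω : HopfDual k H) :
    counit (R := k) ω = pairing k H 1 ω := rfl

@[simp] theorem evL_comul (h : H) (ω : HopfDual k H) : evL h (comul (R := k) ω) = regR ω h := by
  apply HopfDual.ext
  intro x
  obtain ⟨t, ht⟩ := (TensorProduct.dualDistribEquiv k H H).surjective
    ((LinearMap.mul' k H).dualMap (HopfDual.equiv k H ω))
  have h1 : comul (R := k) ω = TensorProduct.map (HopfDual.equiv k H).symm.toLinearMap
      (HopfDual.equiv k H).symm.toLinearMap t := by
    change TensorProduct.map _ _ ((TensorProduct.dualDistribEquiv k H H).symm _) = _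
    congr 1
    rw [LinearEquiv.symm_apply_eq, ht]
    rfl
  have h2 : ∀ s : Module.Dual k H ⊗[k] Module.Dual k H,
      pairing k H x (evL h (TensorProduct.map (HopfDual.equiv k H).symm.toLinearMap
        (HopfDual.equiv k H).symm.toLinearMap s)) =
        TensorProduct.dualDistribEquiv k H H s (h ⊗ₜ x) := by
    intro s
    induction s with
    | zero => simp
    | add z w hz hw => simp only [map_add, LinearMap.add_apply, hz, hw]
    | tmul z w =>
      simp [TensorProduct.dualDistribEquiv, TensorProduct.dualDistribEquivOfBasis]
  rw [h1, h2, ht]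
  rfl

@[simp] theorem evR_comul (h : H) (ω : HopfDual k H) : evR h (comul (R := k) ω) = regL h ω := by
  apply HopfDual.ext
  intro x
  simp [pairing_evR]

instance HopfDual.coalgebra : Coalgebra k (HopfDual k H) where
  coassoc := by
    apply LinearMap.ext
    intro ω
    apply evL_ext
    intro x
    have h1 : ∀ t : HopfDual k H ⊗[k] HopfDual k H,
        evL x (TensorProduct.assoc k _ _ _ ((comul (R := k)).rTensor (HopfDual k H) t)) =
          (regR.flip x).rTensor _ t := by
      intro t
      induction t with
      | zero => simp
      | add z w hz hw => simp only [map_add, hz, hw]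
      | tmul z w =>
        have : ∀ s : HopfDual k H ⊗[k] HopfDual k H,
          evL x (TensorProduct.assoc k _ _ _ (s ⊗ₜ[k] w)) = (evL x s) ⊗ₜ[k] w := by
          intro s
          induction s with
          | zero => simp
          | add a b ha hb => simp only [map_add, TensorProduct.add_tmul, ha, hb]
          | tmul a b => simp [TensorProduct.smul_tmul']
        simp [this]
    have h2 : ∀ (y : H) (t : HopfDual k H ⊗[k] HopfDual k H),
        evL y ((regR.flip x).rTensor _ t) = evL (x * y) t := by
      intro y t
      induction t with
      | zero => simp
      | add z w hz hw => simp only [map_add, hz, hw]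
      | tmul z w => simp
    simp only [LinearMap.comp_apply, LinearEquiv.coe_coe, h1, evL_lTensor, evL_comul]
    apply evL_ext
    intro y
    rw [h2, evL_comul, evL_comul]
    apply HopfDual.ext
    intro z
    simp [mul_assoc]
  rTensor_counit_comp_comul := by
    apply LinearMap.ext
    intro ω
    apply (TensorProduct.lid k _).injective
    change evL 1 (comul ω) = _
    rw [evL_comul]
    apply HopfDual.ext; simp
  lTensor_counit_comp_comul := by
    apply LinearMap.ext
    intro ω
    apply (TensorProduct.rid k _).injective
    change evR 1 (comul ω) = _
    rw [evR_comul]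
    apply HopfDual.ext; simp

instance HopfDual.bialgebra : Bialgebra k (HopfDual k H) :=
  Bialgebra.mk' k _
    (by simp)
    (by intro a b; simp [HopfDual.counit_apply, pairing_one_mul])
    (by
      apply evL_ext
      intro x
      apply HopfDual.ext
      simp [Algebra.TensorProduct.one_def])
    (by
      intro a b
      apply evL_ext
      intro x
      rw [evL_comul, evL_mul _ _ (ℛ k x), regR_mul (ℛ k x)]
      simp)

theorem pairing_map_mul (f g : H →ₗ[k] H) (f' g' : HopfDual k H →ₗ[k] HopfDual k H)
    (hf : ∀ h ω, pairing k H h (f' ω) = pairing k H (f h) ω)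
    (hg : ∀ h ω, pairing k H h (g' ω) = pairing k H (g h) ω)
    {ι : Type*} {h : H} (r : Coalgebra.Repr k h ι) (t : HopfDual k H ⊗[k] HopfDual k H) :
    pairing k H h (LinearMap.mul' k _ (TensorProduct.map f' g' t)) =
      ∑ i ∈ r.index, pairing k H (g (r.right i)) (evL (f (r.left i)) t) := by
  induction t with
  | zero => simp
  | add z w hz hw => simp only [map_add, hz, hw, Finset.sum_add_distrib]
  | tmul z w => simp [pairing_mul r, hf, hg]

/-- The antipode of `Ĥ` is the transpose of the antipode of `H`. -/
instance HopfDual.hopfAlgebraStruct : HopfAlgebraStruct k (HopfDual k H) where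
  antipode := (HopfDual.equiv k H).symm.toLinearMap ∘ₗ (antipode k (A := H)).dualMap ∘ₗ
    (HopfDual.equiv k H).toLinearMap

@[simp] theorem pairing_antipode (h : H) (ω : HopfDual k H) :
    pairing k H h (antipode k ω) = pairing k H (antipode k h) ω := rfl

instance HopfDual.hopfAlgebra : HopfAlgebra k (HopfDual k H) where
  mul_antipode_rTensor_comul := by
    apply LinearMap.ext
    intro ω
    apply HopfDual.ext
    intro h
    refine (pairing_map_mul (antipode k) LinearMap.id _ LinearMap.id pairing_antipode
      (fun _ _ => rfl) (ℛ k h) _).trans ?_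
    simp only [evL_comul, pairing_regR, LinearMap.id_apply]
    rw [← LinearMap.sum_apply, ← map_sum, sum_antipode_mul_eq_smul]
    simp [Algebra.algebraMap_eq_smul_one, mul_comm]
  mul_antipode_lTensor_comul := by
    apply LinearMap.ext
    intro ω
    apply HopfDual.ext
    intro h
    refine (pairing_map_mul LinearMap.id (antipode k) LinearMap.id _ (fun _ _ => rfl)
      pairing_antipode (ℛ k h) _).trans ?_
    simp only [evL_comul, pairing_regR, LinearMap.id_apply]
    rw [← LinearMap.sum_apply, ← map_sum, sum_mul_antipode_eq_smul]
    simp [Algebra.algebraMap_eq_smul_one, mul_comm]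

/-! ### Canonical element -/

variable (k H) in
/-- The canonical element `U = ∑ hᵢ ⊗ ĥᵢ` of `H ⊗ Ĥ`. -/
def canonicalElement : H ⊗[k] HopfDual k H :=
  ∑ i, Module.finBasis k H i ⊗ₜ[k] (HopfDual.equiv k H).symm ((Module.finBasis k H).coord i)

@[simp] theorem evR_canonicalElement (h : H) : evR h (canonicalElement k H) = h := by
  simp only [canonicalElement, map_sum, evR_tmul, pairing_symm, Module.Basis.coord_apply]
  exact (Module.finBasis k H).sum_repr h

theorem tensor_ext {x y : H ⊗[k] H} (h : ∀ ω θ : HopfDual k H,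
    TensorProduct.lid k k (TensorProduct.map ((pairing k H).flip ω) ((pairing k H).flip θ) x) =
    TensorProduct.lid k k (TensorProduct.map ((pairing k H).flip ω) ((pairing k H).flip θ) y)) :
    x = y := by
  let b := Module.finBasis k H
  apply (b.tensorProduct b).ext_elem
  rintro ⟨i, j⟩
  have := h ((HopfDual.equiv k H).symm (b.coord i)) ((HopfDual.equiv k H).symm (b.coord j))
  have key : ∀ z : H ⊗[k] H, (b.tensorProduct b).repr z (i, j) = TensorProduct.lid k k
      (TensorProduct.map ((pairing k H).flip ((HopfDual.equiv k H).symm (b.coord i)))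
        ((pairing k H).flip ((HopfDual.equiv k H).symm (b.coord j))) z) := by
    intro z
    induction z with
    | zero => simp
    | add z w hz hw => simp only [map_add, Finsupp.add_apply, hz, hw]
    | tmul z w => simp [mul_comm]
  rw [key, key, this]

theorem comul_antipode (h : H) : comul (R := k) (antipode k h) =
    TensorProduct.map (antipode k) (antipode k) (TensorProduct.comm k H H (comul h)) := by
  apply tensor_ext
  intro ω θ
  have h1 : ∀ a : H, TensorProduct.lid k k (TensorProduct.map ((pairing k H).flip ω)
      ((pairing k H).flip θ) (comul a)) = pairing k H a (ω * θ) := fun a => by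
    rw [pairing_mul (ℛ k a), ← (ℛ k a).eq]; simp
  rw [h1, ← pairing_antipode, antipode_mul_antidistrib, pairing_mul (ℛ k h)]
  conv_rhs => rw [← (ℛ k h).eq]
  simp [mul_comm]

/-! ### Bijectivity of the antipode -/

theorem comul_canonicalElement :
    (comul (R := k)).rTensor (HopfDual k H) (canonicalElement k H) =
      ∑ i, ∑ j, (Module.finBasis k H i ⊗ₜ[k] Module.finBasis k H j) ⊗ₜ[k]
        ((HopfDual.equiv k H).symm ((Module.finBasis k H).coord i) *
          (HopfDual.equiv k H).symm ((Module.finBasis k H).coord j)) := by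
  apply evR_ext
  intro h
  rw [evR_rTensor, evR_canonicalElement]
  simp only [map_sum, evR_tmul, pairing_mul (ℛ k h), pairing_symm, Module.Basis.coord_apply,
    Finset.sum_smul]
  rw [← (ℛ k h).eq]
  have : ∀ l ∈ (ℛ k h).index, (ℛ k h).left l ⊗ₜ[k] (ℛ k h).right l =
      ∑ i, ∑ j, ((Module.finBasis k H).repr ((ℛ k h).left l) i *
        (Module.finBasis k H).repr ((ℛ k h).right l) j) •
          (Module.finBasis k H i ⊗ₜ[k] Module.finBasis k H j) := by
    intro l _
    conv_lhs => rw [← (Module.finBasis k H).sum_repr ((ℛ k h).left l),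
      ← (Module.finBasis k H).sum_repr ((ℛ k h).right l)]
    simp only [TensorProduct.sum_tmul, TensorProduct.tmul_sum, TensorProduct.smul_tmul_smul]
    exact Finset.sum_comm
  rw [Finset.sum_congr rfl this, Finset.sum_comm]
  exact Finset.sum_congr rfl fun i _ => Finset.sum_comm

/-- Replace `∑ Δ(hᵢ) ⊗ ĥᵢ` by `∑ hᵢ ⊗ hⱼ ⊗ ĥᵢ ĥⱼ` inside a linear expression. -/
theorem sum_comul_basis {M : Type*} [AddCommGroup M] [Module k M]
    (G : H ⊗[k] H →ₗ[k] HopfDual k H →ₗ[k] M) :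
    ∑ i, G (comul (Module.finBasis k H i))
        ((HopfDual.equiv k H).symm ((Module.finBasis k H).coord i)) =
      ∑ i, ∑ j, G (Module.finBasis k H i ⊗ₜ[k] Module.finBasis k H j)
        ((HopfDual.equiv k H).symm ((Module.finBasis k H).coord i) *
          (HopfDual.equiv k H).symm ((Module.finBasis k H).coord j)) := by
  have := congrArg (TensorProduct.lift G) (comul_canonicalElement (k := k) (H := H))
  simpa [canonicalElement, map_sum] using this

theorem sum_basis_pairing {M : Type*} [AddCommGroup M] [Module k M] (F : H →ₗ[k] M) (h : H) :
    ∑ i, pairing k H h ((HopfDual.equiv k H).symm ((Module.finBasis k H).coord i)) •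
      F (Module.finBasis k H i) = F h := by
  simp only [pairing_symm, Module.Basis.coord_apply, ← map_smul, ← map_sum]
  rw [(Module.finBasis k H).sum_repr h]

theorem regL_regL (a b : H) (ω : HopfDual k H) : regL a (regL b ω) = regL (a * b) ω := by
  apply HopfDual.ext; simp [mul_assoc]

theorem regL_one (ω : HopfDual k H) : regL 1 ω = ω := by
  apply HopfDual.ext; simp

/-- A representation of `Δ(S(h))` obtained from one of `Δ(h)`. -/
def antipodeRepr {ι : Type*} {h : H} (r : Coalgebra.Repr k h ι) :
    Coalgebra.Repr k (antipode k h) ι where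
  index := r.index
  left i := antipode k (r.right i)
  right i := antipode k (r.left i)
  eq := by rw [comul_antipode, ← r.eq]; simp

theorem mul_regL_antipode_aux (g m : HopfDual k H) (h : H) :
    g * regL (antipode k h) m =
      ∑ i ∈ (ℛ k h).index,
        regL (antipode k ((ℛ k h).left i)) (regL ((ℛ k h).right i) g * m) := by
  apply HopfDual.ext
  intro x
  rw [pairing_mul (ℛ k x), map_sum]
  have key : ∀ y ∈ (ℛ k x).index,
      pairing k H ((ℛ k x).left y) g * pairing k H ((ℛ k x).right y) (regL (antipode k h) m) =
      ∑ i ∈ (ℛ k h).index, ∑ j ∈ (ℛ k ((ℛ k h).left i)).index,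
        pairing k H ((ℛ k x).left y * antipode k ((ℛ k ((ℛ k h).left i)).right j) *
          (ℛ k h).right i) g *
        pairing k H ((ℛ k x).right y * antipode k ((ℛ k ((ℛ k h).left i)).left j)) m := by
    intro y _
    have h1 := congrArg ((TensorProduct.lid k k).toLinearMap ∘ₗ TensorProduct.map
      ((pairing k H).flip m ∘ₗ LinearMap.mulLeft k ((ℛ k x).right y) ∘ₗ antipode k)
      ((pairing k H).flip g ∘ₗ LinearMap.mulLeft k ((ℛ k x).left y) ∘ₗ LinearMap.mul' k H ∘ₗ
        TensorProduct.map (antipode k) LinearMap.id))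
      (sum_tmul_tmul_eq (ℛ k h) (fun i => ℛ k ((ℛ k h).left i)) (fun i => ℛ k ((ℛ k h).right i)))
    simp only [map_sum, LinearMap.comp_apply, TensorProduct.map_tmul, LinearEquiv.coe_coe,
      TensorProduct.lid_tmul, LinearMap.flip_apply, LinearMap.mulLeft_apply, LinearMap.mul'_apply,
      LinearMap.id_apply, smul_eq_mul] at h1
    have h2 : ∀ i ∈ (ℛ k h).index, ∑ j ∈ (ℛ k ((ℛ k h).right i)).index,
        pairing k H ((ℛ k x).right y * antipode k ((ℛ k h).left i)) m *
          pairing k H ((ℛ k x).left y * (antipode k ((ℛ k ((ℛ k h).right i)).left j) *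
            (ℛ k ((ℛ k h).right i)).right j)) g =
        pairing k H ((ℛ k x).right y * antipode k ((ℛ k h).left i)) m *
          (counit (R := k) ((ℛ k h).right i) * pairing k H ((ℛ k x).left y) g) := by
      intro i _
      rw [← Finset.mul_sum, ← LinearMap.sum_apply, ← map_sum, ← Finset.mul_sum,
        sum_antipode_mul_eq_smul]
      simp
    rw [Finset.sum_congr rfl h2] at h1
    have h3 : ∑ i ∈ (ℛ k h).index, counit (R := k) ((ℛ k h).right i) • (ℛ k h).left i = h := by
      have := congrArg (TensorProduct.rid k H) (sum_tmul_counit_eq (R := k) (ℛ k h))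
      simpa only [map_sum, TensorProduct.rid_tmul, one_smul] using this
    rw [pairing_regL]
    conv_lhs => rw [← h3]
    simp only [map_sum, Finset.mul_sum, LinearMap.sum_apply, mul_assoc, map_smul,
      Algebra.mul_smul_comm, LinearMap.smul_apply, smul_eq_mul] at h1 ⊢
    refine Eq.trans ?_ (h1.symm.trans ?_)
    · exact Finset.sum_congr rfl fun i _ => by ring
    · exact Finset.sum_congr rfl fun i _ => Finset.sum_congr rfl fun j _ => by ring
  rw [Finset.sum_congr rfl key, Finset.sum_comm]
  refine Finset.sum_congr rfl fun i _ => ?_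
  rw [pairing_regL, pairing_mul ((ℛ k x).mul (antipodeRepr (ℛ k ((ℛ k h).left i))))]
  simp [Coalgebra.Repr.mul, Finset.sum_product, antipodeRepr]

/-- `g * (S(h) ▶ m) = S(h₍₁₎) ▶ ((h₍₂₎ ▶ g) * m)`. -/
theorem mul_regL_antipode (g m : HopfDual k H) {ι : Type*} {h : H} (r : Coalgebra.Repr k h ι) :
    g * regL (antipode k h) m =
      ∑ i ∈ r.index, regL (antipode k (r.left i)) (regL (r.right i) g * m) := by
  let G : H ⊗[k] H →ₗ[k] HopfDual k H := TensorProduct.lift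
    (LinearMap.mk₂ k (fun a b => regL (antipode k a) (regL b g * m))
      (fun a a' b => by simp) (fun c a b => by simp)
      (fun a b b' => by simp [add_mul]) (fun c a b => by simp))
  have h1 := congrArg G (r.eq.trans (ℛ k h).eq.symm)
  rw [mul_regL_antipode_aux]
  simpa [G] using h1.symm

/-- The projection of `Ĥ` onto left integrals. -/
def integralProj (f : HopfDual k H) : HopfDual k H :=
  ∑ i, regL (antipode k (antipode k (Module.finBasis k H i)))
    ((HopfDual.equiv k H).symm ((Module.finBasis k H).coord i) * f)

theorem mul_integralProj (g f : HopfDual k H) :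
    g * integralProj f = pairing k H 1 g • integralProj f := by
  let S : H →ₗ[k] H := antipode k
  -- `G (a ⊗ b) θ = S S(b) ▶ ((S(a) ▶ g) * θ * f)`
  let G : H ⊗[k] H →ₗ[k] HopfDual k H →ₗ[k] HopfDual k H := TensorProduct.lift
    (LinearMap.mk₂ k (fun a b => regL (S (S b)) ∘ₗ LinearMap.mulLeft k (regL (S a) g) ∘ₗ
        LinearMap.mulRight k f)
      (fun a a' b => by ext θ; simp [add_mul])
      (fun c a b => by ext θ; simp)
      (fun a b b' => by ext θ; simp)
      (fun c a b => by ext θ; simp))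
  have hG : ∀ a b θ, G (a ⊗ₜ b) θ = regL (S (S b)) (regL (S a) g * (θ * f)) := fun a b θ => rfl
  have h1 : ∀ (a : H) (θ : HopfDual k H), g * regL (S (S a)) (θ * f) = G (comul a) θ := by
    intro a θ
    rw [mul_regL_antipode g (θ * f) (antipodeRepr (ℛ k a)), ← (ℛ k a).eq]
    simp only [map_sum, LinearMap.sum_apply, hG]
    rfl
  have h2 : ∑ i, regL (S (Module.finBasis k H i)) g *
      ((HopfDual.equiv k H).symm ((Module.finBasis k H).coord i)) =
        pairing k H 1 g • (1 : HopfDual k H) := by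
    apply HopfDual.ext
    intro x
    simp only [map_sum, pairing_mul (ℛ k x), pairing_regL]
    rw [Finset.sum_comm]
    have : ∀ y ∈ (ℛ k x).index, ∑ i, pairing k H ((ℛ k x).left y * S (Module.finBasis k H i)) g *
      pairing k H ((ℛ k x).right y) ((HopfDual.equiv k H).symm ((Module.finBasis k H).coord i)) =
        pairing k H ((ℛ k x).left y * S ((ℛ k x).right y)) g := by
      intro y _
      refine Eq.trans ?_ (sum_basis_pairing ((pairing k H).flip g ∘ₗ
        LinearMap.mulLeft k ((ℛ k x).left y) ∘ₗ S) ((ℛ k x).right y))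
      exact Finset.sum_congr rfl fun i _ => by simp [mul_comm]
    rw [Finset.sum_congr rfl this, ← LinearMap.sum_apply, ← map_sum,
      sum_mul_antipode_eq_smul]
    simp [mul_comm]
  unfold integralProj
  rw [Finset.mul_sum]
  change ∑ i, g * regL (S (S _)) _ = _
  simp only [h1]
  rw [sum_comul_basis]
  simp only [hG]
  rw [Finset.sum_comm, Finset.smul_sum]
  refine Finset.sum_congr rfl fun j _ => ?_
  rw [← map_sum]
  simp only [← mul_assoc]
  rw [← Finset.sum_mul, ← Finset.sum_mul, h2]
  simp [S]

theorem sum_regL_integralProj (f : HopfDual k H) :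
    ∑ i, regL (antipode k (Module.finBasis k H i))
      (integralProj ((HopfDual.equiv k H).symm ((Module.finBasis k H).coord i) * f)) = f := by
  let S : H →ₗ[k] H := antipode k
  -- `G (a ⊗ b) θ = S(S(a) b) ▶ (θ * f)`
  let G : H ⊗[k] H →ₗ[k] HopfDual k H →ₗ[k] HopfDual k H :=
    (LinearMap.compl₂ regL (LinearMap.mulRight k f)) ∘ₗ S ∘ₗ LinearMap.mul' k H ∘ₗ
      TensorProduct.map S LinearMap.id
  have hG : ∀ a b θ, G (a ⊗ₜ b) θ = regL (S (S a * b)) (θ * f) := fun a b θ => by simp [G]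
  have h := sum_comul_basis (k := k) (H := H) G
  have h1 : ∀ a θ, G (comul a) θ = counit (R := k) a • (θ * f) := by
    intro a θ
    have : LinearMap.mul' k H (TensorProduct.map S LinearMap.id (comul a)) =
      algebraMap k H (counit a) := mul_antipode_rTensor_comul_apply a
    simp only [G, LinearMap.comp_apply, this]
    apply HopfDual.ext
    simp [Algebra.algebraMap_eq_smul_one, S]
  simp only [h1, hG] at h
  have h2 : ∑ i, counit (R := k) (Module.finBasis k H i) •
      (HopfDual.equiv k H).symm ((Module.finBasis k H).coord i) = 1 := by
    apply HopfDual.ext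
    intro x
    rw [pairing_one]
    refine Eq.trans ?_ (sum_basis_pairing (M := k) (counit (R := k) (A := H)) x)
    simp [mul_comm]
  simp only [← smul_mul_assoc] at h
  rw [← Finset.sum_mul, h2, one_mul] at h
  conv_rhs => rw [h]
  rw [Finset.sum_comm]
  refine Finset.sum_congr rfl fun i _ => ?_
  rw [integralProj, map_sum]
  refine Finset.sum_congr rfl fun j _ => ?_
  rw [regL_regL, ← antipode_mul_antidistrib, mul_assoc]

theorem exists_integral :
    ∃ l : HopfDual k H, l ≠ 0 ∧ ∀ g : HopfDual k H, g * l = pairing k H 1 g • l := by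
  by_contra! hc
  have h0 : ∀ f : HopfDual k H, integralProj f = 0 := by
    intro f
    by_contra hf
    obtain ⟨g, hg⟩ := hc _ hf
    exact hg (mul_integralProj g f)
  have h1 := sum_regL_integralProj (1 : HopfDual k H)
  simp only [h0, map_zero, Finset.sum_const_zero] at h1
  have h2 := congrArg (pairing k H 1) h1
  simp at h2

/-- The antipode of a finite-dimensional Hopf algebra is bijective (Larson–Sweedler). -/
theorem antipode_bijective : Function.Bijective (antipode k (A := H)) := by
  suffices hinj : Function.Injective (antipode k (A := H)) from
    ⟨hinj, LinearMap.injective_iff_surjective.mp hinj⟩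
  rw [← LinearMap.ker_eq_bot, LinearMap.ker_eq_bot']
  intro h hh
  obtain ⟨l, hl0, hl⟩ := exists_integral (k := k) (H := H)
  let S : H →ₗ[k] H := antipode k
  -- `T = (S(h₍₁₎) ▶ l) ⊗ h₍₂₎` vanishes
  let E : H →ₗ[k] HopfDual k H := regL.flip l ∘ₗ S
  have hT : TensorProduct.map E LinearMap.id (comul (R := k) h) = 0 := by
    apply evL_ext
    intro x
    rw [map_zero, ← Module.forall_dual_apply_eq_zero_iff k]
    intro φ
    let g := (HopfDual.equiv k H).symm φ
    have h1 := mul_regL_antipode g l (ℛ k h)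
    rw [hh, map_zero, LinearMap.zero_apply, mul_zero] at h1
    have h2 := congrArg (pairing k H x) h1
    rw [← (ℛ k h).eq]
    simp only [hl, map_sum, map_smul, pairing_regL, one_mul, map_zero] at h2
    simp only [map_sum, TensorProduct.map_tmul, evL_tmul, map_smul, LinearMap.id_apply]
    rw [h2]
    exact Finset.sum_congr rfl fun i _ => mul_comm _ _
  -- contract `T` with `m ⊗ c ↦ (S S(c₍₁₎) ▶ m) ⊗ c₍₂₎`
  let K : HopfDual k H ⊗[k] (H ⊗[k] H) →ₗ[k] HopfDual k H ⊗[k] H :=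
    (TensorProduct.lift (regL.flip.compl₂ (S ∘ₗ S))).rTensor H ∘ₗ
      (TensorProduct.assoc k _ _ _).symm.toLinearMap
  have hK : ∀ a b c, K (E a ⊗ₜ (b ⊗ₜ c)) = regL (S (a * S b)) l ⊗ₜ[k] c := by
    intro a b c
    simp [K, E, regL_regL, S, antipode_mul_antidistrib]
  have h3 := congrArg (fun t => K (TensorProduct.map E LinearMap.id t))
    (sum_tmul_tmul_eq (ℛ k h) (fun i => ℛ k ((ℛ k h).left i)) (fun i => ℛ k ((ℛ k h).right i)))
  have h4 : K (TensorProduct.map E LinearMap.id (∑ i ∈ (ℛ k h).index,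
      ∑ j ∈ (ℛ k ((ℛ k h).right i)).index, (ℛ k h).left i ⊗ₜ[k]
        ((ℛ k ((ℛ k h).right i)).left j ⊗ₜ[k] (ℛ k ((ℛ k h).right i)).right j))) = 0 := by
    have h5 := congrArg (fun t => K ((comul (R := k)).lTensor _ t)) hT
    simp only [map_zero] at h5
    rw [← h5]
    conv_rhs => rw [← (ℛ k h).eq]
    simp only [map_sum, TensorProduct.map_tmul, LinearMap.lTensor_tmul, LinearMap.id_apply]
    refine Finset.sum_congr rfl fun i _ => ?_
    conv_rhs => rw [← (ℛ k ((ℛ k h).right i)).eq]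
    simp only [TensorProduct.tmul_sum, map_sum]
  simp only [h4] at h3
  simp only [map_sum, TensorProduct.map_tmul, LinearMap.id_apply, hK,
    ← TensorProduct.sum_tmul] at h3
  simp only [← LinearMap.sum_apply, ← map_sum] at h3
  simp only [S, sum_mul_antipode_eq_smul, map_smul, antipode_one, LinearMap.smul_apply, regL_one,
    TensorProduct.smul_tmul, ← TensorProduct.tmul_sum, sum_counit_smul] at h3
  by_contra hne
  apply hl0
  apply HopfDual.ext
  intro x
  have h6 := congrArg (evL x) h3
  rw [evL_tmul, map_zero] at h6
  rw [map_zero]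
  exact (smul_eq_zero.mp h6).resolve_right hne

variable (k H) in
/-- The antipode as a linear automorphism; its inverse is `S⁻¹`. -/
def antipodeEquiv : H ≃ₗ[k] H := LinearEquiv.ofBijective (antipode k) antipode_bijective

@[simp] theorem antipode_antipodeEquiv_symm (h : H) :
    antipode k ((antipodeEquiv k H).symm h) = h := (antipodeEquiv k H).apply_symm_apply h

@[simp] theorem antipodeEquiv_symm_antipode (h : H) :
    (antipodeEquiv k H).symm (antipode k h) = h := (antipodeEquiv k H).symm_apply_apply h

theorem antipodeEquiv_symm_mul (a b : H) : (antipodeEquiv k H).symm (a * b) =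
    (antipodeEquiv k H).symm b * (antipodeEquiv k H).symm a := by
  apply antipode_bijective (k := k).1
  simp [antipode_mul_antidistrib]

end Dual

section Double
variable {k H : Type*} [Field k] [Ring H] [HopfAlgebra k H] [FiniteDimensional k H]

variable (k H) in
/-- The canonical element `U ∈ H ⊗ Ĥ` as a unit, with `U⁻¹ = (S ⊗ id)(U)`. -/
def unitU : (H ⊗[k] HopfDual k H)ˣ where
  val := canonicalElement k H
  inv := (antipode k).rTensor _ (canonicalElement k H)
  val_inv := by
    apply evR_ext
    intro h
    rw [evR_mul _ _ (ℛ k h)]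
    simp only [evR_rTensor, evR_canonicalElement, sum_mul_antipode_eq_smul]
    simp [Algebra.TensorProduct.one_def]
  inv_val := by
    apply evR_ext
    intro h
    rw [evR_mul _ _ (ℛ k h)]
    simp only [evR_rTensor, evR_canonicalElement, sum_antipode_mul_eq_smul]
    simp [Algebra.TensorProduct.one_def]

variable (k H) in
/-- The element `°U = (op ⊗ id)(U) ∈ Hᵒᵖ ⊗ Ĥ` as a unit, with `°U⁻¹ = (op S⁻¹ ⊗ id)(U)`. -/
def unitUop : (Hᵐᵒᵖ ⊗[k] HopfDual k H)ˣ where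
  val := (MulOpposite.opLinearEquiv k).toLinearMap.rTensor _ (canonicalElement k H)
  inv := ((MulOpposite.opLinearEquiv k).toLinearMap ∘ₗ
    (antipodeEquiv k H).symm.toLinearMap).rTensor _ (canonicalElement k H)
  val_inv := by
    apply evR_ext
    intro h
    rw [evR_mul _ _ (ℛ k h)]
    apply MulOpposite.unop_injective
    apply antipode_bijective (k := k).1
    simp [evR_rTensor, antipode_mul_antidistrib, sum_antipode_mul_eq_smul,
      Algebra.TensorProduct.one_def]
  inv_val := by
    apply evR_ext
    intro h
    rw [evR_mul _ _ (ℛ k h)]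
    apply MulOpposite.unop_injective
    apply antipode_bijective (k := k).1
    simp [evR_rTensor, antipode_mul_antidistrib, sum_mul_antipode_eq_smul,
      Algebra.TensorProduct.one_def]

section Ad
variable {A : Type*} [Ring A] [Algebra k A]

variable (k) in
/-- `Ad(W)(x) = W x W⁻¹` for an invertible element `W` of an algebra. -/
def Ad (W : Aˣ) : A ≃ₐ[k] A :=
  AlgEquiv.ofAlgHom
    (AlgHom.ofLinearMap (LinearMap.mulLeft k (W : A) ∘ₗ LinearMap.mulRight k ((W⁻¹ : Aˣ) : A))
      (by simp) (by intro x y; simp [mul_assoc]))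
    (AlgHom.ofLinearMap (LinearMap.mulLeft k ((W⁻¹ : Aˣ) : A) ∘ₗ LinearMap.mulRight k (W : A))
      (by simp) (by intro x y; simp [mul_assoc]))
    (by ext x; simp [mul_assoc]) (by ext x; simp [mul_assoc])

theorem Ad_apply (W : Aˣ) (x : A) : Ad k W x = W * x * ((W⁻¹ : Aˣ) : A) := by
  simp [Ad, mul_assoc]

theorem Ad_symm_apply (W : Aˣ) (x : A) : (Ad k W).symm x = ((W⁻¹ : Aˣ) : A) * x * W := by
  simp [Ad, mul_assoc]

end Ad

/-! ### Twisted products -/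
section Twisted
variable {A B : Type*} [Ring A] [Algebra k A] [Ring B] [Algebra k B]

/-- The product `(m_A ⊗ m_B)(id ⊗ τ ⊗ id)` on `A ⊗ B` given by `τ : B ⊗ A → A ⊗ B`. -/
def twistedMul (τ : B ⊗[k] A →ₗ[k] A ⊗[k] B) :
    A ⊗[k] B →ₗ[k] A ⊗[k] B →ₗ[k] A ⊗[k] B :=
  TensorProduct.curry <|
    TensorProduct.map (LinearMap.mul' k A) (LinearMap.mul' k B) ∘ₗ
    (TensorProduct.assoc k A A (B ⊗[k] B)).symm.toLinearMap ∘ₗ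
    (TensorProduct.assoc k A B B).toLinearMap.lTensor A ∘ₗ
    (τ.rTensor B).lTensor A ∘ₗ
    (TensorProduct.assoc k B A B).symm.toLinearMap.lTensor A ∘ₗ
    (TensorProduct.assoc k A B (A ⊗[k] B)).toLinearMap

theorem twistedMul_tmul (τ : B ⊗[k] A →ₗ[k] A ⊗[k] B) (a a' : A) (b b' : B) :
    twistedMul τ (a ⊗ₜ b) (a' ⊗ₜ b') =
      (LinearMap.mulLeft k a).rTensor B ((LinearMap.mulRight k b').lTensor A (τ (b ⊗ₜ a'))) := by
  simp only [twistedMul, TensorProduct.curry_apply, LinearMap.comp_apply, LinearEquiv.coe_coe,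
    TensorProduct.assoc_tmul, LinearMap.lTensor_tmul, TensorProduct.assoc_symm_tmul,
    LinearMap.rTensor_tmul]
  induction τ (b ⊗ₜ[k] a') with
  | zero => simp
  | add x y hx hy => simp only [TensorProduct.add_tmul, TensorProduct.tmul_add, map_add, hx, hy]
  | tmul x y => simp

variable {τ : B ⊗[k] A →ₗ[k] A ⊗[k] B}

theorem twistedMul_lmul (a : A) (x y : A ⊗[k] B) :
    twistedMul τ ((LinearMap.mulLeft k a).rTensor B x) y =
      (LinearMap.mulLeft k a).rTensor B (twistedMul τ x y) := by
  induction x with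
  | zero => simp
  | add x x' hx hx' => simp only [map_add, LinearMap.add_apply, hx, hx']
  | tmul c d =>
    induction y with
    | zero => simp
    | add y y' hy hy' => simp only [map_add, hy, hy']
    | tmul e f =>
      simp only [LinearMap.rTensor_tmul, LinearMap.mulLeft_apply, twistedMul_tmul,
        LinearMap.mulLeft_mul, LinearMap.rTensor_comp, LinearMap.comp_apply]

theorem twistedMul_rmul (b : B) (x y : A ⊗[k] B) :
    twistedMul τ x ((LinearMap.mulRight k b).lTensor A y) =
      (LinearMap.mulRight k b).lTensor A (twistedMul τ x y) := by
  have hc : ∀ (a : A) (z : A ⊗[k] B), (LinearMap.mulRight k b).lTensor A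
      ((LinearMap.mulLeft k a).rTensor B z) =
      (LinearMap.mulLeft k a).rTensor B ((LinearMap.mulRight k b).lTensor A z) := by
    intro a z
    rw [← LinearMap.comp_apply, ← LinearMap.comp_apply, LinearMap.lTensor_comp_rTensor,
      LinearMap.rTensor_comp_lTensor]
  induction x with
  | zero => simp
  | add x x' hx hx' => simp only [map_add, LinearMap.add_apply, hx, hx']
  | tmul c d =>
    induction y with
    | zero => simp
    | add y y' hy hy' => simp only [map_add, hy, hy']
    | tmul e f =>
      simp only [LinearMap.lTensor_tmul, LinearMap.mulRight_apply, twistedMul_tmul,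
        LinearMap.mulRight_mul, LinearMap.lTensor_comp, LinearMap.comp_apply, hc]

theorem twistedMul_assoc
    (h₁ : ∀ b b' a, τ ((b * b') ⊗ₜ a) = twistedMul τ (1 ⊗ₜ b) (τ (b' ⊗ₜ a)))
    (h₂ : ∀ b a a', τ (b ⊗ₜ (a * a')) = twistedMul τ (τ (b ⊗ₜ a)) (a' ⊗ₜ 1))
    (x y z : A ⊗[k] B) :
    twistedMul τ (twistedMul τ x y) z = twistedMul τ x (twistedMul τ y z) := by
  have e1 : ∀ (b' : B) (a : A) (s : A ⊗[k] B),
      twistedMul τ ((LinearMap.mulRight k b').lTensor A s) (a ⊗ₜ 1) =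
        twistedMul τ s (τ (b' ⊗ₜ a)) := by
    intro b' a s
    induction s with
    | zero => simp
    | add x x' hx hx' => simp only [map_add, LinearMap.add_apply, hx, hx']
    | tmul c d =>
      have : c ⊗ₜ[k] d = (LinearMap.mulLeft k c).rTensor B (1 ⊗ₜ d) := by simp
      rw [this, twistedMul_lmul, ← h₁]
      simp [twistedMul_tmul]
  have e2 : ∀ (b : B) (a : A) (s : A ⊗[k] B),
      twistedMul τ (1 ⊗ₜ b) ((LinearMap.mulLeft k a).rTensor B s) =
        twistedMul τ (τ (b ⊗ₜ a)) s := by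
    intro b a s
    induction s with
    | zero => simp
    | add x x' hx hx' => simp only [map_add, hx, hx']
    | tmul c d =>
      have : c ⊗ₜ[k] d = (LinearMap.mulRight k d).lTensor A (c ⊗ₜ 1) := by simp
      rw [this, twistedMul_rmul, ← h₂]
      simp [twistedMul_tmul]
  induction x with
  | zero => simp
  | add x x' hx hx' => simp only [map_add, LinearMap.add_apply, hx, hx']
  | tmul a b =>
    induction y with
    | zero => simp
    | add x x' hx hx' => simp only [map_add, LinearMap.add_apply, hx, hx']
    | tmul a' b' =>
      induction z with
      | zero => simp
      | add x x' hx hx' => simp only [map_add, hx, hx']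
      | tmul a'' b'' =>
        have h3 : a ⊗ₜ[k] b = (LinearMap.mulLeft k a).rTensor B (1 ⊗ₜ b) := by simp
        have h4 : a'' ⊗ₜ[k] b'' = (LinearMap.mulRight k b'').lTensor A (a'' ⊗ₜ 1) := by simp
        rw [h3, h4]
        simp only [twistedMul_lmul, twistedMul_rmul]
        rw [twistedMul_tmul τ 1 a' b b', twistedMul_tmul τ a' a'' b' 1]
        simp only [LinearMap.mulLeft_one, LinearMap.mulRight_one, LinearMap.rTensor_id,
          LinearMap.lTensor_id, LinearMap.id_apply]
        rw [e1, e2]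

theorem one_twistedMul (h : ∀ a, τ (1 ⊗ₜ a) = a ⊗ₜ 1) (x : A ⊗[k] B) :
    twistedMul τ (1 ⊗ₜ 1) x = x := by
  induction x with
  | zero => simp
  | add x x' hx hx' => simp only [map_add, hx, hx']
  | tmul a b => simp [twistedMul_tmul, h]

theorem twistedMul_one (h : ∀ b, τ (b ⊗ₜ 1) = 1 ⊗ₜ b) (x : A ⊗[k] B) :
    twistedMul τ x (1 ⊗ₜ 1) = x := by
  induction x with
  | zero => simp
  | add x x' hx hx' => simp only [map_add, LinearMap.add_apply, hx, hx']
  | tmul a b => simp [twistedMul_tmul, h]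

end Twisted

/-! ### The Heisenberg algebra -/

variable (k H) in
/-- The map `h ⊗ θ ↦ (h₍₁₎ ▶ θ) ⊗ h₍₂₎`. -/
def heisenbergTwist : H ⊗[k] HopfDual k H →ₗ[k] HopfDual k H ⊗[k] H :=
  (TensorProduct.lift regL).rTensor H ∘ₗ
    (TensorProduct.rightComm k H H (HopfDual k H)).toLinearMap ∘ₗ
    (comul (R := k)).rTensor (HopfDual k H)

theorem heisenbergTwist_tmul {ι : Type*} {h : H} (r : Coalgebra.Repr k h ι) (θ : HopfDual k H) :
    heisenbergTwist k H (h ⊗ₜ θ) = ∑ i ∈ r.index, regL (r.left i) θ ⊗ₜ[k] r.right i := by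
  simp [heisenbergTwist, ← r.eq, TensorProduct.sum_tmul]

theorem heisenbergTwist_mul (b b' : H) (a : HopfDual k H) :
    heisenbergTwist k H ((b * b') ⊗ₜ a) =
      twistedMul (heisenbergTwist k H) (1 ⊗ₜ b) (heisenbergTwist k H (b' ⊗ₜ a)) := by
  rw [heisenbergTwist_tmul ((ℛ k b).mul (ℛ k b')), heisenbergTwist_tmul (ℛ k b')]
  simp only [map_sum, twistedMul_tmul, heisenbergTwist_tmul (ℛ k b)]
  simp [Coalgebra.Repr.mul, Finset.sum_product, regL_regL]
  exact Finset.sum_comm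

theorem heisenbergTwist_mul_right (b : H) (a a' : HopfDual k H) :
    heisenbergTwist k H (b ⊗ₜ (a * a')) =
      twistedMul (heisenbergTwist k H) (heisenbergTwist k H (b ⊗ₜ a)) (a' ⊗ₜ 1) := by
  rw [heisenbergTwist_tmul (ℛ k b), heisenbergTwist_tmul (ℛ k b)]
  simp only [map_sum, LinearMap.sum_apply, twistedMul_tmul, LinearMap.mulRight_one,
    LinearMap.lTensor_id, LinearMap.id_apply]
  have h1 := congrArg ((LinearMap.mul' k (HopfDual k H) ∘ₗ
      TensorProduct.map (regL.flip a) (regL.flip a')).rTensor H ∘ₗ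
      (TensorProduct.assoc k H H H).symm.toLinearMap)
    (sum_tmul_tmul_eq (ℛ k b) (fun i => ℛ k ((ℛ k b).left i)) (fun i => ℛ k ((ℛ k b).right i)))
  simp only [map_sum, LinearMap.comp_apply, LinearEquiv.coe_coe, TensorProduct.assoc_symm_tmul,
    LinearMap.rTensor_tmul, TensorProduct.map_tmul, LinearMap.flip_apply,
    LinearMap.mul'_apply] at h1
  refine Eq.trans ?_ (h1.trans ?_)
  · refine Finset.sum_congr rfl fun i _ => ?_
    rw [regL_mul (ℛ k ((ℛ k b).left i)), TensorProduct.sum_tmul]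
  · refine Finset.sum_congr rfl fun i _ => ?_
    rw [heisenbergTwist_tmul (ℛ k ((ℛ k b).right i)), map_sum]
    simp

variable (k H) in
/-- The Heisenberg algebra `ℋ(Ĥ) = Ĥ # H`: the vector space `Ĥ ⊗ H` with the smash product
`(θ # h)(θ' # h') = θ (h₍₁₎ ▶ θ') # h₍₂₎ h'`. -/
def Heisenberg : Type _ := HopfDual k H ⊗[k] H

instance Heisenberg.addCommGroup : AddCommGroup (Heisenberg k H) :=
  inferInstanceAs (AddCommGroup (HopfDual k H ⊗[k] H))

instance Heisenberg.ring : Ring (Heisenberg k H) where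
  __ := Heisenberg.addCommGroup
  mul x y := twistedMul (heisenbergTwist k H) x y
  one := (1 : HopfDual k H) ⊗ₜ[k] (1 : H)
  left_distrib x y z := map_add (twistedMul (heisenbergTwist k H) x) y z
  right_distrib x y z := LinearMap.map_add₂ (twistedMul (heisenbergTwist k H)) x y z
  zero_mul x := LinearMap.map_zero₂ (twistedMul (heisenbergTwist k H)) x
  mul_zero x := map_zero (twistedMul (heisenbergTwist k H) x)
  mul_assoc := twistedMul_assoc heisenbergTwist_mul heisenbergTwist_mul_right
  one_mul := one_twistedMul fun a => by
    rw [heisenbergTwist_tmul (⟨{()}, fun _ => 1, fun _ => 1,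
      by simp [Algebra.TensorProduct.one_def]⟩ : Coalgebra.Repr k (1 : H) Unit)]
    simp [regL_one]
  mul_one := twistedMul_one fun b => by
    have h1 : ∀ h : H, regL h (1 : HopfDual k H) = counit (R := k) h • (1 : HopfDual k H) := by
      intro h; apply HopfDual.ext; simp [mul_comm]
    rw [heisenbergTwist_tmul (ℛ k b)]
    simp only [h1, TensorProduct.smul_tmul, ← TensorProduct.tmul_sum, sum_counit_smul]

instance Heisenberg.algebra : Algebra k (Heisenberg k H) :=
  letI : Module k (Heisenberg k H) := inferInstanceAs (Module k (HopfDual k H ⊗[k] H))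
  Algebra.ofModule
    (fun r x y => LinearMap.map_smul₂ (twistedMul (heisenbergTwist k H)) r x y)
    (fun r x y => map_smul (twistedMul (heisenbergTwist k H) x) r y)

namespace Heisenberg

variable (k H) in
/-- The element `θ # h`, as a bilinear map. -/
def smash : HopfDual k H →ₗ[k] H →ₗ[k] Heisenberg k H where
  toFun θ :=
    { toFun := fun h => θ ⊗ₜ[k] h
      map_add' := fun a b => TensorProduct.tmul_add θ a b
      map_smul' := fun c a => TensorProduct.tmul_smul c θ a }
  map_add' θ θ' := LinearMap.ext fun h => TensorProduct.add_tmul θ θ' h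
  map_smul' c θ := LinearMap.ext fun h => TensorProduct.smul_tmul' c θ h

theorem one_def : (1 : Heisenberg k H) = smash k H 1 1 := rfl

theorem smash_mul_smash (θ θ' : HopfDual k H) {h : H} (h' : H) {ι : Type*}
    (r : Coalgebra.Repr k h ι) : smash k H θ h * smash k H θ' h' =
      ∑ i ∈ r.index, smash k H (θ * regL (r.left i) θ') (r.right i * h') := by
  change twistedMul (heisenbergTwist k H) (θ ⊗ₜ h) (θ' ⊗ₜ h') = _
  rw [twistedMul_tmul, heisenbergTwist_tmul r]
  simp only [map_sum, LinearMap.lTensor_tmul, LinearMap.rTensor_tmul, LinearMap.mulLeft_apply,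
    LinearMap.mulRight_apply]
  rfl

variable (k H) in
/-- The inclusion `ι̂₁ : Ĥ → ℋ(Ĥ)`, `θ ↦ θ # 1`. -/
def incl₁ : HopfDual k H →ₐ[k] Heisenberg k H :=
  AlgHom.ofLinearMap ((smash k H).flip 1) rfl fun θ θ' => by
    simp only [LinearMap.flip_apply]
    rw [smash_mul_smash θ θ' 1 (⟨{()}, fun _ => 1, fun _ => 1,
      by simp [Algebra.TensorProduct.one_def]⟩ : Coalgebra.Repr k (1 : H) Unit)]
    simp [regL_one]

variable (k H) in
/-- The inclusion `ι̂₂ : H → ℋ(Ĥ)`, `h ↦ 1 # h`. -/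
def incl₂ : H →ₐ[k] Heisenberg k H :=
  AlgHom.ofLinearMap (smash k H 1) rfl fun h h' => by
    have h1 : ∀ h : H, regL h (1 : HopfDual k H) = counit (R := k) h • (1 : HopfDual k H) := by
      intro h; apply HopfDual.ext; simp [mul_comm]
    rw [smash_mul_smash 1 1 h' (ℛ k h)]
    simp only [h1, one_mul]
    conv_lhs => rw [← sum_counit_smul (R := k) (ℛ k h)]
    simp [Finset.sum_mul]

variable (k H) in
/-- `𝕍 = (ι̂₁ ⊗ id)(Σ(°U)) ∈ ℋ(Ĥ) ⊗ Hᵒᵖ`. -/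
def unitV : (Heisenberg k H ⊗[k] Hᵐᵒᵖ)ˣ :=
  Units.map ((Algebra.TensorProduct.map (incl₁ k H) (AlgHom.id k Hᵐᵒᵖ)).comp
    (Algebra.TensorProduct.comm k Hᵐᵒᵖ (HopfDual k H)).toAlgHom : _ →* _) (unitUop k H)

variable (k H) in
/-- `𝕌 = (ι̂₂ ⊗ id)(U) ∈ ℋ(Ĥ) ⊗ Ĥ`. -/
def unitUH : (Heisenberg k H ⊗[k] HopfDual k H)ˣ :=
  Units.map (Algebra.TensorProduct.map (incl₂ k H) (AlgHom.id k (HopfDual k H)) : _ →* _)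
    (unitU k H)

variable (k H) in
/-- `α(x) = 𝕍 (x ⊗ 1) 𝕍⁻¹`. -/
def alpha : Heisenberg k H →ₐ[k] Heisenberg k H ⊗[k] Hᵐᵒᵖ :=
  (Ad k (unitV k H)).toAlgHom.comp Algebra.TensorProduct.includeLeft

variable (k H) in
/-- `β(x) = 𝕌 (x ⊗ 1) 𝕌⁻¹`. -/
def beta : Heisenberg k H →ₐ[k] Heisenberg k H ⊗[k] HopfDual k H :=
  (Ad k (unitUH k H)).toAlgHom.comp Algebra.TensorProduct.includeLeft

end Heisenberg

/-! ### Coactions and Yetter--Drinfeld algebras -/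

/-- A right coaction of `C` on an algebra `X`: an algebra homomorphism `ρ : X → X ⊗ C` with
`(ρ ⊗ id) ρ = (id ⊗ Δ) ρ` and `(id ⊗ ε) ρ = id`. -/
structure IsRightCoaction {X C : Type*} [Ring X] [Algebra k X] [Ring C] [Algebra k C]
    [CoalgebraStruct k C] (ρ : X →ₐ[k] X ⊗[k] C) : Prop where
  coassoc : ∀ x : X, TensorProduct.assoc k X C C (ρ.toLinearMap.rTensor C (ρ x)) =
    (comul (R := k)).lTensor X (ρ x)
  counit : ∀ x : X, TensorProduct.rid k X ((counit (R := k)).lTensor X (ρ x)) = x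

/-- The map `(α ⊗ id) β : X → X ⊗ (Hᵒᵖ ⊗ Ĥ)`. -/
def compCoaction {X : Type*} [Ring X] [Algebra k X] (α : X →ₐ[k] X ⊗[k] Hᵐᵒᵖ)
    (β : X →ₐ[k] X ⊗[k] HopfDual k H) : X →ₐ[k] X ⊗[k] (Hᵐᵒᵖ ⊗[k] HopfDual k H) :=
  (Algebra.TensorProduct.assoc k k k X Hᵐᵒᵖ (HopfDual k H)).toAlgHom.comp
    ((Algebra.TensorProduct.map α (AlgHom.id k (HopfDual k H))).comp β)

/-- Right-right `(H, Ĥ)`-Yetter--Drinfeld algebras: `α` is a right coaction of `Hᵒᵖ`, `β` is a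
right coaction of `Ĥ`, and
`(α ⊗ id) β = (id ⊗ Ad(°U)⁻¹) (id ⊗ Σ) (β ⊗ id) α`. -/
structure IsYetterDrinfeldRR {X : Type*} [Ring X] [Algebra k X] (α : X →ₐ[k] X ⊗[k] Hᵐᵒᵖ)
    (β : X →ₐ[k] X ⊗[k] HopfDual k H) : Prop where
  isRightCoaction_left : IsRightCoaction α
  isRightCoaction_right : IsRightCoaction β
  compat : ∀ x : X, compCoaction α β x =
    (Ad k (unitUop k H)).symm.toLinearMap.lTensor X
      ((TensorProduct.comm k (HopfDual k H) Hᵐᵒᵖ).toLinearMap.lTensor X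
        (TensorProduct.assoc k X (HopfDual k H) Hᵐᵒᵖ (β.toLinearMap.rTensor Hᵐᵒᵖ (α x))))

/-! ### The Drinfeld codouble -/

variable (k H) in
/-- The Drinfeld codouble `𝒯(H)`: the tensor product algebra `Hᵒᵖ ⊗ Ĥ` with the coproduct
`(id ⊗ Σ Ad(°U) ⊗ id) (Δ ⊗ Δ̂)` and the counit `ε ⊗ ε̂`. -/
def Codouble : Type _ := Hᵐᵒᵖ ⊗[k] HopfDual k H

namespace Codouble

instance ring : Ring (Codouble k H) := inferInstanceAs (Ring (Hᵐᵒᵖ ⊗[k] HopfDual k H))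

instance algebra : Algebra k (Codouble k H) :=
  inferInstanceAs (Algebra k (Hᵐᵒᵖ ⊗[k] HopfDual k H))

variable (k H) in
/-- The identity map `Hᵒᵖ ⊗ Ĥ → 𝒯(H)`. -/
def equiv : (Hᵐᵒᵖ ⊗[k] HopfDual k H) ≃ₐ[k] Codouble k H := AlgEquiv.refl

/-- For a linear endomorphism `f` of `B ⊗ C`, the endomorphism `id ⊗ f ⊗ id` of
`(A ⊗ B) ⊗ (C ⊗ D)`. -/
def middle {A B C D : Type*} [AddCommGroup A] [Module k A] [AddCommGroup B] [Module k B]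
    [AddCommGroup C] [Module k C] [AddCommGroup D] [Module k D]
    (f : B ⊗[k] C →ₗ[k] B ⊗[k] C) :
    (A ⊗[k] B) ⊗[k] (C ⊗[k] D) →ₗ[k] (A ⊗[k] B) ⊗[k] (C ⊗[k] D) :=
  (TensorProduct.assoc k A B (C ⊗[k] D)).symm.toLinearMap ∘ₗ
    ((TensorProduct.assoc k B C D).toLinearMap ∘ₗ f.rTensor D ∘ₗ
      (TensorProduct.assoc k B C D).symm.toLinearMap).lTensor A ∘ₗ
    (TensorProduct.assoc k A B (C ⊗[k] D)).toLinearMap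

instance coalgebraStruct : CoalgebraStruct k (Codouble k H) where
  comul := TensorProduct.map (equiv k H).toLinearMap (equiv k H).toLinearMap ∘ₗ
    (TensorProduct.tensorTensorTensorComm k Hᵐᵒᵖ Hᵐᵒᵖ (HopfDual k H) (HopfDual k H)).toLinearMap ∘ₗ
    middle (Ad k (unitUop k H)).toLinearMap ∘ₗ
    TensorProduct.map (comul (R := k)) (comul (R := k)) ∘ₗ (equiv k H).symm.toLinearMap
  counit := (TensorProduct.lid k k).toLinearMap ∘ₗ
    TensorProduct.map (counit (R := k)) (counit (R := k)) ∘ₗ (equiv k H).symm.toLinearMap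

end Codouble

/-- The map `Γ = (α ⊗ id) β : X → X ⊗ 𝒯(H)`. -/
def codoubleCoaction {X : Type*} [Ring X] [Algebra k X] (α : X →ₐ[k] X ⊗[k] Hᵐᵒᵖ)
    (β : X →ₐ[k] X ⊗[k] HopfDual k H) : X →ₐ[k] X ⊗[k] Codouble k H :=
  (Algebra.TensorProduct.map (AlgHom.id k X) (Codouble.equiv k H).toAlgHom).comp
    (compCoaction α β)

/-! ### The Drinfeld double -/

variable (k H) in
/-- The map `𝔗(a ⊗ θ) = (a₍₁₎ ▶ θ ◀ S⁻¹(a₍₃₎)) ⊗ a₍₂₎`. -/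
def doubleTwist : H ⊗[k] HopfDual k H →ₗ[k] HopfDual k H ⊗[k] H :=
  (TensorProduct.lift (regR.compl₂ (antipodeEquiv k H).symm.toLinearMap)).rTensor H ∘ₗ
    (TensorProduct.assoc k (HopfDual k H) H H).symm.toLinearMap ∘ₗ
    ((TensorProduct.comm k H H).toLinearMap ∘ₗ comul (R := k)).lTensor (HopfDual k H) ∘ₗ
    heisenbergTwist k H

theorem doubleTwist_tmul {ι : Type*} {κ : ι → Type*} {a : H} (r : Coalgebra.Repr k a ι)
    (s : ∀ i, Coalgebra.Repr k (r.right i) (κ i)) (θ : HopfDual k H) :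
    doubleTwist k H (a ⊗ₜ θ) = ∑ i ∈ r.index, ∑ j ∈ (s i).index,
      regR (regL (r.left i) θ) ((antipodeEquiv k H).symm ((s i).right j)) ⊗ₜ[k] (s i).left j := by
  simp only [doubleTwist, LinearMap.comp_apply, heisenbergTwist_tmul r, map_sum,
    LinearMap.lTensor_tmul]
  refine Finset.sum_congr rfl fun i _ => ?_
  conv_lhs => rw [← (s i).eq]
  simp [TensorProduct.tmul_sum]

variable (k H) in
/-- The Drinfeld double `𝒟(H) = Ĥᶜᵒ ⋈ H`: the vector space `Ĥ ⊗ H` with the product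
`(ω ⋈ a)(θ ⋈ b) = ω (a₍₁₎ ▶ θ ◀ S⁻¹(a₍₃₎)) ⋈ a₍₂₎ b`, the unit `1 ⋈ 1`, the coproduct
`Δ(ω ⋈ a) = (ω₍₂₎ ⋈ a₍₁₎) ⊗ (ω₍₁₎ ⋈ a₍₂₎)` and the counit `ε(ω ⋈ a) = ω(1) ε(a)`. -/
def DrinfeldDouble : Type _ := HopfDual k H ⊗[k] H

namespace DrinfeldDouble

instance addCommGroup : AddCommGroup (DrinfeldDouble k H) :=
  inferInstanceAs (AddCommGroup (HopfDual k H ⊗[k] H))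

instance module : Module k (DrinfeldDouble k H) :=
  inferInstanceAs (Module k (HopfDual k H ⊗[k] H))

variable (k H) in
/-- The identity map `Ĥ ⊗ H → 𝒟(H)`. -/
def equiv : (HopfDual k H ⊗[k] H) ≃ₗ[k] DrinfeldDouble k H := LinearEquiv.refl k _

variable (k H) in
/-- The element `ω ⋈ h` of `𝒟(H)`. -/
def bowtie (ω : HopfDual k H) (h : H) : DrinfeldDouble k H := equiv k H (ω ⊗ₜ[k] h)

instance one : One (DrinfeldDouble k H) := ⟨bowtie k H 1 1⟩

instance mul : Mul (DrinfeldDouble k H) :=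
  ⟨fun x y => equiv k H
    (twistedMul (doubleTwist k H) ((equiv k H).symm x) ((equiv k H).symm y))⟩

instance coalgebraStruct : CoalgebraStruct k (DrinfeldDouble k H) where
  comul := TensorProduct.map (equiv k H).toLinearMap (equiv k H).toLinearMap ∘ₗ
    (TensorProduct.tensorTensorTensorComm k (HopfDual k H) (HopfDual k H) H H).toLinearMap ∘ₗ
    TensorProduct.map ((TensorProduct.comm k (HopfDual k H) (HopfDual k H)).toLinearMap ∘ₗ
      comul (R := k)) (comul (R := k)) ∘ₗ (equiv k H).symm.toLinearMap
  counit := (TensorProduct.lid k k).toLinearMap ∘ₗ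
    TensorProduct.map (counit (R := k)) (counit (R := k)) ∘ₗ (equiv k H).symm.toLinearMap

theorem bowtie_mul_bowtie (ω θ : HopfDual k H) (b : H) {ι : Type*} {κ : ι → Type*} {a : H}
    (r : Coalgebra.Repr k a ι) (s : ∀ i, Coalgebra.Repr k (r.right i) (κ i)) :
    bowtie k H ω a * bowtie k H θ b = ∑ i ∈ r.index, ∑ j ∈ (s i).index,
      bowtie k H (ω * regR (regL (r.left i) θ) ((antipodeEquiv k H).symm ((s i).right j)))
        ((s i).left j * b) := by
  change equiv k H (twistedMul (doubleTwist k H) (ω ⊗ₜ a) (θ ⊗ₜ b)) = _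
  rw [twistedMul_tmul, doubleTwist_tmul r s]
  simp [map_sum, bowtie]

end DrinfeldDouble

variable (k H) in
/-- The canonical pairing `p_𝒟(ω ⋈ h, cᵒᵖ ⊗ θ) = ω(c) θ(h)` of `𝒟(H)` and `𝒯(H)`. -/
def doublePairing : DrinfeldDouble k H →ₗ[k] Codouble k H →ₗ[k] k :=
  TensorProduct.curry <|
    (TensorProduct.lid k k).toLinearMap ∘ₗ
    TensorProduct.map
      (TensorProduct.lift ((pairing k H).flip.compl₂ (MulOpposite.opLinearEquiv k).symm.toLinearMap))
      (TensorProduct.lift (pairing k H)) ∘ₗ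
    (TensorProduct.tensorTensorTensorComm k (HopfDual k H) H Hᵐᵒᵖ (HopfDual k H)).toLinearMap ∘ₗ
    TensorProduct.map (DrinfeldDouble.equiv k H).symm.toLinearMap
      (Codouble.equiv k H).symm.toLinearMap

theorem doublePairing_apply (ω θ : HopfDual k H) (h c : H) :
    doublePairing k H (DrinfeldDouble.bowtie k H ω h)
      (Codouble.equiv k H (MulOpposite.op c ⊗ₜ θ)) = pairing k H c ω * pairing k H h θ := by
  simp [doublePairing, DrinfeldDouble.bowtie]

/-- The map `d ▷ x = (id ⊗ p_𝒟(d, ·)) (γ(x))` induced by `γ : X → X ⊗ 𝒯(H)`. -/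
def inducedAction {X : Type*} [Ring X] [Algebra k X] (γ : X →ₐ[k] X ⊗[k] Codouble k H) :
    DrinfeldDouble k H →ₗ[k] X →ₗ[k] X where
  toFun d := (TensorProduct.rid k X).toLinearMap ∘ₗ (doublePairing k H d).lTensor X ∘ₗ
    γ.toLinearMap
  map_add' d e := by
    simp only [map_add, LinearMap.lTensor_add, LinearMap.add_comp, LinearMap.comp_add]
  map_smul' c d := by
    simp only [map_smul, LinearMap.lTensor_smul, LinearMap.smul_comp, LinearMap.comp_smul,
      RingHom.id_apply]

/-- A left action of `D` on an algebra `X` (that is, a left `D`-module algebra structure):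
`1 ▷ x = x`, `(d e) ▷ x = d ▷ (e ▷ x)`, `d ▷ 1 = ε(d) 1` and
`d ▷ (x y) = (d₍₁₎ ▷ x)(d₍₂₎ ▷ y)`. -/
structure IsLeftAction {D X : Type*} [AddCommGroup D] [Module k D] [One D] [Mul D]
    [CoalgebraStruct k D] [Ring X] [Algebra k X] (act : D →ₗ[k] X →ₗ[k] X) : Prop where
  one_act : ∀ x, act 1 x = x
  mul_act : ∀ d e x, act (d * e) x = act d (act e x)
  act_one : ∀ d, act d 1 = counit (R := k) d • (1 : X)
  act_mul : ∀ d x y, act d (x * y) =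
    LinearMap.mul' k X (TensorProduct.map (act.flip x) (act.flip y) (comul (R := k) d))

/-- The right regular action of `Ĥ` on `H`: `h ◀ ω = p(h₍₁₎, ω) h₍₂₎`. -/
def dualRegR (h : H) (ω : HopfDual k H) : H :=
  TensorProduct.lid k H (((pairing k H).flip ω).rTensor H (comul (R := k) h))

variable (k H) in
/-- The coaction `Γ = (α ⊗ id) β` of `𝒯(H)` on `ℋ(Ĥ)`. -/
def Heisenberg.coaction : Heisenberg k H →ₐ[k] Heisenberg k H ⊗[k] Codouble k H :=
  codoubleCoaction (Heisenberg.alpha k H) (Heisenberg.beta k H)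

variable (k H) in
/-- The map `▷_Γ : 𝒟(H) ⊗ ℋ(Ĥ) → ℋ(Ĥ)` induced by `Γ`. -/
def Heisenberg.action : DrinfeldDouble k H →ₗ[k] Heisenberg k H →ₗ[k] Heisenberg k H :=
  inducedAction (Heisenberg.coaction k H)

end Double

end

end HeisenbergYD

open HeisenbergYD

/-! Everything is finite-dimensional, so a coaction of `C` is the same thing as an action of the
algebra dual to `C`, and an identity between tensors may be tested by applying functionals to their
legs. Here the functionals on `Hᵒᵖ` are the `ω ∈ Ĥ` and those on `Ĥ` are the `h ∈ H`.

Slicing `𝕍`, `𝕍⁻¹`, `𝕌`, `𝕌⁻¹` in this way gives `ω`, `Ŝ⁻¹(ω)`, `h`, `S(h)` inside `ℋ(Ĥ)`. Hence `α`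
and `β` are dual to the adjoint actions `x ↦ ω₍₂₎ x Ŝ⁻¹(ω₍₁₎)` and `x ↦ h₍₁₎ x S(h₍₂₎)`
(`contract_alpha`, `contract_beta`). These are actions because coproducts are multiplicative and
`Ŝ⁻¹`, `S` are antimultiplicative.

For the compatibility condition, `(α ⊗ id) β` is conjugation by `𝕍₁₂ 𝕌₁₃`, and `(β ⊗ id) α`, with
its last legs flipped, is conjugation by `𝕌₁₃ 𝕍₁₂`. They agree up to `Ad(°U)` as soon as `°U₂₃ 𝕍₁₂
𝕌₁₃ = 𝕌₁₃ 𝕍₁₂` (`compat_of_pentagon`). Sliced by `h` and `ω`, this `pentagon` relation is the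
commutation rule `h ω = (h₍₁₎ ▶ ω) h₍₂₎` of the Heisenberg algebra.

The passage to the double works for every Yetter–Drinfeld algebra. The transpose of `Ad(°U)` is the
twist `a ⊗ θ ↦ (a₍₁₎ ▶ θ ◀ S⁻¹(a₍₃₎)) ⊗ a₍₂₎` (`doublePairing_doubleTwist`), so the product of
`𝒟(H)` is dual to the coproduct of `𝒯(H)`. Since `ω ⋈ h` acts through `Γ` as `h` followed by `ω`,
what is needed for an action of `𝒟(H)` is the rule for moving `a` past `θ`, and this rule is the
dual form of the compatibility condition (`IsYetterDrinfeldRR.exchange`). The explicit formula comes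
from composing the two adjoint actions and reordering with the commutation rule. -/

namespace HeisenbergYD

noncomputable section

/-! ### Slicing tensors by functionals, and coactions as dual actions -/

section Contract
variable {k : Type*} [Field k] {A B M N : Type*} [AddCommGroup A] [Module k A] [AddCommGroup B]
  [Module k B] [AddCommGroup M] [Module k M] [AddCommGroup N] [Module k N]

/-- The map `id ⊗ f : A ⊗ M → A` for a functional `f` on `M`. -/
def contract (f : M →ₗ[k] k) : A ⊗[k] M →ₗ[k] A :=
  (TensorProduct.rid k A).toLinearMap ∘ₗ f.lTensor A

@[simp] theorem contract_tmul (f : M →ₗ[k] k) (a : A) (m : M) :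
    contract f (a ⊗ₜ[k] m) = f m • a := rfl

theorem contract_rTensor (f : M →ₗ[k] k) (g : A →ₗ[k] B) (z : A ⊗[k] M) :
    contract f (g.rTensor M z) = g (contract f z) := by
  induction z with
  | zero => simp
  | add z w hz hw => simp only [map_add, hz, hw]
  | tmul a m => simp

theorem contract_lTensor (f : N →ₗ[k] k) (g : M →ₗ[k] N) (z : A ⊗[k] M) :
    contract f (g.lTensor A z) = contract (f ∘ₗ g) z := by
  induction z with
  | zero => simp
  | add z w hz hw => simp only [map_add, hz, hw]
  | tmul a m => simp

/-- The coordinate functionals of a basis of `M` already determine a tensor in `A ⊗ M`. -/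
theorem contract_ext [FiniteDimensional k M] {z w : A ⊗[k] M}
    (h : ∀ f : M →ₗ[k] k, contract f z = contract f w) : z = w := by
  classical
  apply (TensorProduct.equivFinsuppOfBasisRight (Module.finBasis k M)).injective
  ext i
  rw [TensorProduct.equivFinsuppOfBasisRight_apply, TensorProduct.equivFinsuppOfBasisRight_apply]
  exact h ((Module.finBasis k M).coord i)

/-- The functional `f ⊗ g` on `M ⊗ N`. -/
def tensorFunctional (f : M →ₗ[k] k) (g : N →ₗ[k] k) : M ⊗[k] N →ₗ[k] k :=
  (TensorProduct.lid k k).toLinearMap ∘ₗ TensorProduct.map f g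

@[simp] theorem tensorFunctional_tmul (f : M →ₗ[k] k) (g : N →ₗ[k] k) (m : M) (n : N) :
    tensorFunctional f g (m ⊗ₜ[k] n) = f m * g n := rfl

theorem contract_tensorFunctional_assoc (f : M →ₗ[k] k) (g : N →ₗ[k] k) (z : (A ⊗[k] M) ⊗[k] N) :
    contract (tensorFunctional f g) (TensorProduct.assoc k A M N z) =
      contract f (contract g z) := by
  induction z with
  | zero => simp
  | add z w hz hw => simp only [map_add, hz, hw]
  | tmul y n =>
    induction y with
    | zero => simp
    | add z w hz hw => simp only [TensorProduct.add_tmul, map_add, hz, hw]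
    | tmul a m => simp [smul_smul, mul_comm]

theorem contract_tensorFunctional_ext [FiniteDimensional k M] [FiniteDimensional k N]
    {z w : A ⊗[k] (M ⊗[k] N)} (h : ∀ (f : M →ₗ[k] k) (g : N →ₗ[k] k),
      contract (tensorFunctional f g) z = contract (tensorFunctional f g) w) : z = w := by
  obtain ⟨z, rfl⟩ := (TensorProduct.assoc k A M N).surjective z
  obtain ⟨w, rfl⟩ := (TensorProduct.assoc k A M N).surjective w
  congr 1
  refine contract_ext fun g => contract_ext fun f => ?_
  simpa only [contract_tensorFunctional_assoc] using h f g

/-- Slices of a product are convolutions of slices, governed by the transpose `f ↦ ∑ uᵢ ⊗ vᵢ` of the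
product of `M`. This is what turns conjugation by a unit into an adjoint action. -/
theorem contract_mul {A M : Type*} [Ring A] [Algebra k A] [Ring M] [Algebra k M]
    {ι : Type*} (s : Finset ι) (f : M →ₗ[k] k) (u v : ι → M →ₗ[k] k)
    (h : ∀ m n, f (m * n) = ∑ i ∈ s, u i m * v i n) (x y : A ⊗[k] M) :
    contract f (x * y) = ∑ i ∈ s, contract (u i) x * contract (v i) y := by
  induction x with
  | zero => simp
  | add x x' hx hx' => simp only [add_mul, map_add, hx, hx', Finset.sum_add_distrib]
  | tmul a b =>
    induction y with
    | zero => simp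
    | add x x' hx hx' => simp only [mul_add, map_add, hx, hx', Finset.sum_add_distrib]
    | tmul c d =>
      simp [Algebra.TensorProduct.tmul_mul_tmul, h, Finset.sum_smul, smul_smul, mul_comm]

theorem contract_mul_tmul_one {A M : Type*} [Ring A] [Algebra k A] [Ring M] [Algebra k M]
    (f : M →ₗ[k] k) (x : A ⊗[k] M) (a : A) : contract f (x * a ⊗ₜ 1) = contract f x * a := by
  induction x with
  | zero => simp
  | add x x' hx hx' => simp only [add_mul, map_add, hx, hx']
  | tmul b m => simp

theorem contract_tmul_one_mul {A M : Type*} [Ring A] [Algebra k A] [Ring M] [Algebra k M]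
    (f : M →ₗ[k] k) (x : A ⊗[k] M) (a : A) : contract f (a ⊗ₜ 1 * x) = a * contract f x := by
  induction x with
  | zero => simp
  | add x x' hx hx' => simp only [mul_add, map_add, hx, hx']
  | tmul b m => simp

theorem contract_one_tmul_mul {A M : Type*} [Ring A] [Algebra k A] [Ring M] [Algebra k M]
    (f : M →ₗ[k] k) (m : M) (x : A ⊗[k] M) :
    contract f (1 ⊗ₜ m * x) = contract (f ∘ₗ LinearMap.mulLeft k m) x := by
  induction x with
  | zero => simp
  | add x x' hx hx' => simp only [mul_add, map_add, hx, hx']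
  | tmul b m => simp

theorem sum_repr_mul {A M : Type*} [Ring A] [Bialgebra k A] [AddCommGroup M] {ι κ : Type*}
    {a b : A} (r : Coalgebra.Repr k a ι) (s : Coalgebra.Repr k b κ) (F : A → A → M) :
    ∑ i ∈ (r.mul s).index, F ((r.mul s).left i) ((r.mul s).right i) =
      ∑ i ∈ r.index, ∑ j ∈ s.index, F (r.left i * s.left j) (r.right i * s.right j) := by
  simp [Coalgebra.Repr.mul, Finset.sum_product]

/-- Coactions of `C` correspond to actions of an algebra `D` paired with `C`. -/
theorem isRightCoaction_iff {X C D : Type*} [Ring X] [Algebra k X] [Ring C] [Algebra k C]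
    [CoalgebraStruct k C] [FiniteDimensional k C] [One D] [Mul D] (P : D → C →ₗ[k] k)
    (hP : Function.Surjective P) (hone : P 1 = counit (R := k))
    (hmul : ∀ d e, P (d * e) = tensorFunctional (P d) (P e) ∘ₗ comul (R := k))
    (ρ : X →ₐ[k] X ⊗[k] C) :
    IsRightCoaction ρ ↔ (∀ x, contract (P 1) (ρ x) = x) ∧
      ∀ d e x, contract (P (d * e)) (ρ x) = contract (P d) (ρ (contract (P e) (ρ x))) := by
  -- Slicing `(ρ ⊗ id) ρ` acts by `e` through the last leg and then by `d` through the remaining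
  -- one.
  have key : ∀ d e x, contract (tensorFunctional (P d) (P e))
      (TensorProduct.assoc k X C C (ρ.toLinearMap.rTensor C (ρ x))) =
        contract (P d) (ρ (contract (P e) (ρ x))) := fun d e x => by
    rw [contract_tensorFunctional_assoc, contract_rTensor]
    rfl
  constructor
  · intro h
    refine ⟨fun x => ?_, fun d e x => ?_⟩
    · rw [hone]; exact h.counit x
    · rw [hmul, ← contract_lTensor, ← h.coassoc, key]
  · intro h
    refine ⟨fun x => ?_, fun x => ?_⟩
    · refine contract_tensorFunctional_ext fun f g => ?_
      -- Coassociativity is tested on product functionals only, and surjectivity of `P` puts each of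
      -- these in the form `P d ⊗ P e`.
      obtain ⟨d, rfl⟩ := hP f
      obtain ⟨e, rfl⟩ := hP g
      rw [key, contract_lTensor, ← hmul, h.2]
    · have := h.1 x
      rwa [hone] at this

end Contract

/-! ### Functionals on `Hᵒᵖ` and on `Ĥ` -/

section Functionals
variable {k H : Type*} [Field k] [Ring H] [HopfAlgebra k H]

/-- The functional `cᵒᵖ ↦ ω(c)` on `Hᵒᵖ`. -/
def opFunctional : HopfDual k H →ₗ[k] Hᵐᵒᵖ →ₗ[k] k :=
  (pairing k H).flip.compl₂ (MulOpposite.opLinearEquiv k).symm.toLinearMap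

theorem opFunctional_apply (ω : HopfDual k H) (c : Hᵐᵒᵖ) :
    opFunctional ω c = pairing k H c.unop ω := rfl

@[simp] theorem opFunctional_op (ω : HopfDual k H) (c : H) :
    opFunctional ω (MulOpposite.op c) = pairing k H c ω := rfl

theorem opFunctional_surjective :
    Function.Surjective (opFunctional : HopfDual k H →ₗ[k] Hᵐᵒᵖ →ₗ[k] k) := fun f =>
  ⟨(HopfDual.equiv k H).symm (f ∘ₗ (MulOpposite.opLinearEquiv k).toLinearMap), rfl⟩

theorem opFunctional_one : opFunctional (1 : HopfDual k H) = counit (R := k) := rfl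

theorem opFunctional_mul (ω θ : HopfDual k H) :
    opFunctional (ω * θ) =
      tensorFunctional (opFunctional ω) (opFunctional θ) ∘ₗ comul (R := k) := by
  ext c
  rw [opFunctional_apply, pairing_mul (ℛ k c.unop)]
  simp only [MulOpposite.comul_def, LinearMap.comp_apply, LinearEquiv.coe_coe,
    MulOpposite.coe_opLinearEquiv_symm]
  rw [← (ℛ k c.unop).eq]
  simp

variable [FiniteDimensional k H]

theorem pairing_mul_left {ι : Type*} {ω : HopfDual k H} (r : Coalgebra.Repr k ω ι) (a b : H) :
    pairing k H (a * b) ω =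
      ∑ i ∈ r.index, pairing k H a (r.left i) * pairing k H b (r.right i) := by
  rw [← pairing_regR, ← evL_comul, ← r.eq]
  simp

/-- The legs of `ω` appear reversed because the product of `Hᵒᵖ` is. This is the origin of the
co-opposite coproduct `ω₍₂₎ ⊗ ω₍₁₎` on the `Ĥ` part of `𝒟(H)`. -/
theorem opFunctional_mul_apply {ι : Type*} {ω : HopfDual k H} (r : Coalgebra.Repr k ω ι)
    (a b : Hᵐᵒᵖ) : opFunctional ω (a * b) =
      ∑ i ∈ r.index, opFunctional (r.right i) a * opFunctional (r.left i) b := by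
  simp only [opFunctional_apply, MulOpposite.unop_mul, pairing_mul_left r]
  exact Finset.sum_congr rfl fun i _ => mul_comm _ _

/-- In finite dimension this is equivalent to a functional being determined by its values. It allows
the elements of `H` to serve as test functionals on `Ĥ`. -/
theorem pairing_surjective : Function.Surjective (pairing k H) := by
  refine LinearMap.flip_injective_iff₂.mp ?_
  exact (HopfDual.equiv k H).injective

theorem pairing_one_left : pairing k H 1 = counit (R := k) := rfl

theorem pairing_mul_eq_tensorFunctional (a b : H) : pairing k H (a * b) =
    tensorFunctional (pairing k H a) (pairing k H b) ∘ₗ comul (R := k) := by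
  ext ω
  rw [pairing_mul_left (ℛ k ω), LinearMap.comp_apply, ← (ℛ k ω).eq]
  simp

theorem evR_eq_contract {A : Type*} [AddCommGroup A] [Module k A] (h : H) :
    (evR h : A ⊗[k] HopfDual k H →ₗ[k] A) = contract (pairing k H h) := rfl

theorem contract_opFunctional_mul {B : Type*} [Ring B] [Algebra k B] {ι : Type*}
    {ω : HopfDual k H} (r : Coalgebra.Repr k ω ι) (x y : B ⊗[k] Hᵐᵒᵖ) :
    contract (opFunctional ω) (x * y) = ∑ i ∈ r.index,
      contract (opFunctional (r.right i)) x * contract (opFunctional (r.left i)) y :=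
  contract_mul _ _ _ _ (opFunctional_mul_apply r) x y

end Functionals

/-! ### The adjoint actions dual to `α` and `β` -/

section HeisenbergActions
variable {k H : Type*} [Field k] [Ring H] [HopfAlgebra k H] [FiniteDimensional k H]

theorem antipodeEquiv_symm_one : (antipodeEquiv k H).symm 1 = 1 := by
  rw [LinearEquiv.symm_apply_eq]
  exact (antipode_one (R := k) (A := H)).symm

/-- Inverting a transpose gives the transpose of the inverse: evaluate `Ŝ(Ŝ⁻¹(ω))` at `S⁻¹(h)`. -/
theorem antipodeEquiv_dual_symm (ω : HopfDual k H) (h : H) :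
    pairing k H h ((antipodeEquiv k (HopfDual k H)).symm ω) =
      pairing k H ((antipodeEquiv k H).symm h) ω := by
  have := pairing_antipode ((antipodeEquiv k H).symm h) ((antipodeEquiv k (HopfDual k H)).symm ω)
  rw [antipode_antipodeEquiv_symm, antipode_antipodeEquiv_symm] at this
  exact this.symm

/-- Anticomultiplicativity of `S`, applied at `S⁻¹(h)`, with `S ⊗ S` and the flip then undone by
`key`. -/
theorem comul_antipodeEquiv_symm (h : H) : comul (R := k) ((antipodeEquiv k H).symm h) =
    TensorProduct.map (antipodeEquiv k H).symm.toLinearMap (antipodeEquiv k H).symm.toLinearMap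
      (TensorProduct.comm k H H (comul h)) := by
  have key : ∀ t : H ⊗[k] H, TensorProduct.map (antipodeEquiv k H).symm.toLinearMap
      (antipodeEquiv k H).symm.toLinearMap (TensorProduct.comm k H H
        (TensorProduct.map (antipode k) (antipode k) (TensorProduct.comm k H H t))) = t := by
    intro t
    induction t with
    | zero => simp
    | add z w hz hw => simp only [map_add, hz, hw]
    | tmul a b => simp
  have := comul_antipode (k := k) ((antipodeEquiv k H).symm h)
  rw [antipode_antipodeEquiv_symm] at this
  rw [this, key]

/-- A representation of `Δ(S⁻¹(h))` obtained from one of `Δ(h)`. -/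
def antipodeSymmRepr {ι : Type*} {h : H} (r : Coalgebra.Repr k h ι) :
    Coalgebra.Repr k ((antipodeEquiv k H).symm h) ι where
  index := r.index
  left i := (antipodeEquiv k H).symm (r.right i)
  right i := (antipodeEquiv k H).symm (r.left i)
  eq := by rw [comul_antipodeEquiv_symm, ← r.eq]; simp

variable (k H) in
/-- A representation of `Δ(1)`. -/
def oneRepr : Coalgebra.Repr k (1 : H) Unit :=
  ⟨{()}, fun _ => 1, fun _ => 1, by simp [Algebra.TensorProduct.one_def]⟩

/-- Multiplying by `aᵒᵖ` on the left of `Hᵒᵖ` is multiplying by `a` on the right of `H`, so the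
transpose is the left regular action; the next lemma is the mirror case. -/
theorem opFunctional_mul_left (ω : HopfDual k H) (a : H) (c : Hᵐᵒᵖ) :
    opFunctional ω (MulOpposite.op a * c) = opFunctional (regL a ω) c := rfl

theorem opFunctional_mul_right (ω : HopfDual k H) (a : H) (c : Hᵐᵒᵖ) :
    opFunctional ω (c * MulOpposite.op a) = opFunctional (regR ω a) c := rfl

/-- Contracting the first leg of the canonical element. -/
theorem contract_comm_canonicalElement (ω : HopfDual k H) :
    contract ((pairing k H).flip ω)
      (TensorProduct.comm k H (HopfDual k H) (canonicalElement k H)) = ω := by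
  apply HopfDual.ext
  intro h
  simp only [canonicalElement, map_sum, TensorProduct.comm_tmul, contract_tmul, map_smul,
    LinearMap.flip_apply, smul_eq_mul]
  exact (Finset.sum_congr rfl fun i _ => mul_comm _ _).trans
    (sum_basis_pairing ((pairing k H).flip ω) h)

theorem evR_unitUop (h : H) :
    evR h (unitUop k H : Hᵐᵒᵖ ⊗[k] HopfDual k H) = MulOpposite.op h := by
  change evR h (LinearMap.rTensor _ _ (canonicalElement k H)) = _
  rw [evR_rTensor, evR_canonicalElement]
  rfl

theorem evR_unitUop_inv (h : H) :
    evR h (((unitUop k H)⁻¹ : (Hᵐᵒᵖ ⊗[k] HopfDual k H)ˣ) : Hᵐᵒᵖ ⊗[k] HopfDual k H) =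
      MulOpposite.op ((antipodeEquiv k H).symm h) := by
  change evR h (LinearMap.rTensor _ _ (canonicalElement k H)) = _
  rw [evR_rTensor, evR_canonicalElement]
  rfl

theorem evR_unitU (h : H) : evR h (unitU k H : H ⊗[k] HopfDual k H) = h :=
  evR_canonicalElement h

theorem evR_unitU_inv (h : H) :
    evR h (((unitU k H)⁻¹ : (H ⊗[k] HopfDual k H)ˣ) : H ⊗[k] HopfDual k H) = antipode k h := by
  change evR h (LinearMap.rTensor _ _ (canonicalElement k H)) = _
  rw [evR_rTensor, evR_canonicalElement]

/-- The canonical element represents the identity, so slicing the first leg of `(g ⊗ id)(U)` by `ω`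
gives the transpose of `g` at `ω`. Taking `g` to be `op` or `op ∘ S⁻¹` yields the slices of `𝕍` and
`𝕍⁻¹`. -/
theorem contract_comm_rTensor (g : H →ₗ[k] Hᵐᵒᵖ) (ω θ : HopfDual k H)
    (h : ∀ a, opFunctional ω (g a) = pairing k H a θ) :
    contract (opFunctional ω) (TensorProduct.comm k Hᵐᵒᵖ (HopfDual k H)
      (g.rTensor _ (canonicalElement k H))) = θ := by
  have key : ∀ t : H ⊗[k] HopfDual k H, contract (opFunctional ω)
      (TensorProduct.comm k Hᵐᵒᵖ (HopfDual k H) (g.rTensor _ t)) =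
        contract ((pairing k H).flip θ) (TensorProduct.comm k H (HopfDual k H) t) := by
    intro t
    induction t with
    | zero => simp
    | add z w hz hw => simp only [map_add, hz, hw]
    | tmul a b => simp [h]
  rw [key, contract_comm_canonicalElement]

namespace Heisenberg

theorem contract_unitV (ω : HopfDual k H) :
    contract (opFunctional ω) (unitV k H : Heisenberg k H ⊗[k] Hᵐᵒᵖ) = incl₁ k H ω := by
  change contract _ ((incl₁ k H).toLinearMap.rTensor _ (TensorProduct.comm k _ _
    (LinearMap.rTensor _ _ _))) = _
  rw [contract_rTensor, contract_comm_rTensor _ ω ω fun a => rfl]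
  rfl

theorem contract_unitV_inv (ω : HopfDual k H) :
    contract (opFunctional ω) (((unitV k H)⁻¹ : (Heisenberg k H ⊗[k] Hᵐᵒᵖ)ˣ) :
      Heisenberg k H ⊗[k] Hᵐᵒᵖ) = incl₁ k H ((antipodeEquiv k (HopfDual k H)).symm ω) := by
  change contract _ ((incl₁ k H).toLinearMap.rTensor _ (TensorProduct.comm k _ _
    (LinearMap.rTensor _ _ _))) = _
  rw [contract_rTensor, contract_comm_rTensor _ ω ((antipodeEquiv k (HopfDual k H)).symm ω)
    fun a => (antipodeEquiv_dual_symm ω a).symm]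
  rfl

theorem contract_unitUH (h : H) :
    contract (pairing k H h) (unitUH k H : Heisenberg k H ⊗[k] HopfDual k H) = incl₂ k H h := by
  change contract _ ((incl₂ k H).toLinearMap.rTensor _ (unitU k H : H ⊗[k] HopfDual k H)) = _
  rw [contract_rTensor, ← evR_eq_contract, evR_unitU]
  rfl

theorem contract_unitUH_inv (h : H) :
    contract (pairing k H h) (((unitUH k H)⁻¹ : (Heisenberg k H ⊗[k] HopfDual k H)ˣ) :
      Heisenberg k H ⊗[k] HopfDual k H) = incl₂ k H (antipode k h) := by
  change contract _ ((incl₂ k H).toLinearMap.rTensor _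
    (((unitU k H)⁻¹ : (H ⊗[k] HopfDual k H)ˣ) : H ⊗[k] HopfDual k H)) = _
  rw [contract_rTensor, ← evR_eq_contract, evR_unitU_inv]
  rfl

theorem alpha_apply (x : Heisenberg k H) : alpha k H x =
    (unitV k H : Heisenberg k H ⊗[k] Hᵐᵒᵖ) * (x ⊗ₜ 1) *
      (((unitV k H)⁻¹ : (Heisenberg k H ⊗[k] Hᵐᵒᵖ)ˣ) : Heisenberg k H ⊗[k] Hᵐᵒᵖ) :=
  Ad_apply _ _

theorem beta_apply (x : Heisenberg k H) : beta k H x =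
    (unitUH k H : Heisenberg k H ⊗[k] HopfDual k H) * (x ⊗ₜ 1) *
      (((unitUH k H)⁻¹ : (Heisenberg k H ⊗[k] HopfDual k H)ˣ) :
        Heisenberg k H ⊗[k] HopfDual k H) :=
  Ad_apply _ _

/-- The action of `Ĥ` given by `α` is `x ↦ ω₍₂₎ x Ŝ⁻¹(ω₍₁₎)`. -/
theorem contract_alpha {ι : Type*} {ω : HopfDual k H} (r : Coalgebra.Repr k ω ι)
    (x : Heisenberg k H) : contract (opFunctional ω) (alpha k H x) =
      ∑ i ∈ r.index, incl₁ k H (r.right i) * x *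
        incl₁ k H ((antipodeEquiv k (HopfDual k H)).symm (r.left i)) := by
  rw [alpha_apply, contract_opFunctional_mul r]
  refine Finset.sum_congr rfl fun i _ => ?_
  rw [contract_unitV_inv, contract_mul_tmul_one, contract_unitV]

/-- The action of `H` given by `β` is `x ↦ h₍₁₎ x S(h₍₂₎)`. -/
theorem contract_beta {ι : Type*} {h : H} (r : Coalgebra.Repr k h ι)
    (x : Heisenberg k H) : contract (pairing k H h) (beta k H x) =
      ∑ i ∈ r.index, incl₂ k H (r.left i) * x * incl₂ k H (antipode k (r.right i)) := by
  rw [beta_apply, ← evR_eq_contract, evR_mul _ _ r]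
  refine Finset.sum_congr rfl fun i _ => ?_
  rw [evR_eq_contract, evR_eq_contract, contract_unitUH_inv, contract_mul_tmul_one,
    contract_unitUH]

theorem isRightCoaction_alpha : IsRightCoaction (alpha k H) := by
  refine (isRightCoaction_iff (opFunctional : HopfDual k H →ₗ[k] Hᵐᵒᵖ →ₗ[k] k)
    opFunctional_surjective opFunctional_one opFunctional_mul _).mpr
      ⟨fun x => ?_, fun ω θ x => ?_⟩
  · rw [contract_alpha (oneRepr k (HopfDual k H))]
    simp [oneRepr, antipodeEquiv_symm_one]
  -- Multiplying representations of `Δ̂(ω)` and `Δ̂(θ)` represents `Δ̂(ωθ)`; antimultiplicativity of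
  -- `Ŝ⁻¹` then nests the two adjoint actions in the right order.
  · rw [contract_alpha ((ℛ k ω).mul (ℛ k θ)), contract_alpha (ℛ k ω), contract_alpha (ℛ k θ),
      sum_repr_mul (ℛ k ω) (ℛ k θ) fun a b => incl₁ k H b * x *
        incl₁ k H ((antipodeEquiv k (HopfDual k H)).symm a)]
    simp only [Finset.mul_sum, Finset.sum_mul,
      antipodeEquiv_symm_mul, map_mul, mul_assoc]

theorem isRightCoaction_beta : IsRightCoaction (beta k H) := by
  refine (isRightCoaction_iff (pairing k H) pairing_surjective pairing_one_left
    pairing_mul_eq_tensorFunctional _).mpr ⟨fun x => ?_, fun a b x => ?_⟩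
  · rw [contract_beta (oneRepr k H)]
    simp [oneRepr]
  · rw [contract_beta ((ℛ k a).mul (ℛ k b)), contract_beta (ℛ k a), contract_beta (ℛ k b),
      sum_repr_mul (ℛ k a) (ℛ k b) fun a b => incl₂ k H a * x * incl₂ k H (antipode k b)]
    simp only [Finset.mul_sum, Finset.sum_mul,
      antipode_mul_antidistrib, map_mul, mul_assoc]

theorem incl₁_mul_incl₂ (θ : HopfDual k H) (h : H) :
    incl₁ k H θ * incl₂ k H h = smash k H θ h := by
  rw [show incl₂ k H h = smash k H 1 h from rfl, show incl₁ k H θ = smash k H θ 1 from rfl,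
    smash_mul_smash θ 1 h (oneRepr k H)]
  simp [oneRepr, regL_one]

/-- The commutation relation `h θ = (h₍₁₎ ▶ θ) h₍₂₎` in `ℋ(Ĥ)`. -/
theorem incl₂_mul_incl₁ {ι : Type*} {h : H} (r : Coalgebra.Repr k h ι) (θ : HopfDual k H) :
    incl₂ k H h * incl₁ k H θ =
      ∑ i ∈ r.index, incl₁ k H (regL (r.left i) θ) * incl₂ k H (r.right i) := by
  rw [show incl₂ k H h = smash k H 1 h from rfl, show incl₁ k H θ = smash k H θ 1 from rfl,
    smash_mul_smash 1 θ 1 r]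
  refine Finset.sum_congr rfl fun i _ => ?_
  rw [incl₁_mul_incl₂, one_mul, mul_one]

end Heisenberg

end HeisenbergActions

/-! ### Leg numbering and commutation of inner coactions -/

section Legs
variable {k X C E : Type*} [Field k] [Ring X] [Algebra k X] [Ring C] [Algebra k C] [Ring E]
  [Algebra k E]

variable (k X C E) in
/-- The embedding of `X ⊗ C` as the first two legs of `X ⊗ (C ⊗ E)`. -/
def leg₁₂ : X ⊗[k] C →ₐ[k] X ⊗[k] (C ⊗[k] E) :=
  Algebra.TensorProduct.map (AlgHom.id k X) Algebra.TensorProduct.includeLeft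

variable (k X C E) in
/-- The embedding of `X ⊗ E` as the outer two legs of `X ⊗ (C ⊗ E)`. -/
def leg₁₃ : X ⊗[k] E →ₐ[k] X ⊗[k] (C ⊗[k] E) :=
  Algebra.TensorProduct.map (AlgHom.id k X) Algebra.TensorProduct.includeRight

variable (k X C E) in
/-- The embedding of `C ⊗ E` as the last two legs of `X ⊗ (C ⊗ E)`. -/
def leg₂₃ : C ⊗[k] E →ₐ[k] X ⊗[k] (C ⊗[k] E) :=
  Algebra.TensorProduct.includeRight

@[simp] theorem leg₁₂_tmul (x : X) (c : C) :
    leg₁₂ k X C E (x ⊗ₜ c) = x ⊗ₜ (c ⊗ₜ 1) := rfl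
@[simp] theorem leg₁₃_tmul (x : X) (e : E) :
    leg₁₃ k X C E (x ⊗ₜ e) = x ⊗ₜ (1 ⊗ₜ e) := rfl
@[simp] theorem leg₂₃_apply (t : C ⊗[k] E) : leg₂₃ k X C E t = 1 ⊗ₜ t := rfl

theorem assoc_tmul_eq_leg (s : X ⊗[k] C) (e : E) :
    TensorProduct.assoc k X C E (s ⊗ₜ e) = leg₁₂ k X C E s * 1 ⊗ₜ (1 ⊗ₜ e) := by
  induction s with
  | zero => simp
  | add s t hs ht => simp only [TensorProduct.add_tmul, map_add, add_mul, hs, ht]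
  | tmul x c => simp

theorem leg₁₂_commute (s : X ⊗[k] C) (e : E) :
    leg₁₂ k X C E s * 1 ⊗ₜ (1 ⊗ₜ e) = 1 ⊗ₜ (1 ⊗ₜ e) * leg₁₂ k X C E s := by
  induction s with
  | zero => simp
  | add s t hs ht => simp only [map_add, add_mul, mul_add, hs, ht]
  | tmul x c => simp

theorem lTensor_comm_assoc_tmul_eq_leg (s : X ⊗[k] E) (c : C) :
    (TensorProduct.comm k E C).toLinearMap.lTensor X (TensorProduct.assoc k X E C (s ⊗ₜ c)) =
      leg₁₃ k X C E s * 1 ⊗ₜ (c ⊗ₜ 1) := by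
  induction s with
  | zero => simp
  | add s t hs ht => simp only [TensorProduct.add_tmul, map_add, add_mul, hs, ht]
  | tmul x e => simp

theorem leg₁₃_commute (s : X ⊗[k] E) (c : C) :
    leg₁₃ k X C E s * 1 ⊗ₜ (c ⊗ₜ 1) = 1 ⊗ₜ (c ⊗ₜ 1) * leg₁₃ k X C E s := by
  induction s with
  | zero => simp
  | add s t hs ht => simp only [map_add, add_mul, mul_add, hs, ht]
  | tmul x e => simp

/-- Elements `1 ⊗ 1 ⊗ e` commute with the first two legs, so applying the inner coaction `α` to the
`X`-leg of `z` is conjugating `z₁₃` by `V₁₂`. -/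
theorem assoc_rTensor_inner {α : X →ₗ[k] X ⊗[k] C} {V : (X ⊗[k] C)ˣ}
    (hα : ∀ x, α x = (V : X ⊗[k] C) * x ⊗ₜ 1 * ((V⁻¹ : (X ⊗[k] C)ˣ) : X ⊗[k] C))
    (z : X ⊗[k] E) : TensorProduct.assoc k X C E (α.rTensor _ z) =
      leg₁₂ k X C E V * leg₁₃ k X C E z * leg₁₂ k X C E ((V⁻¹ : (X ⊗[k] C)ˣ) : X ⊗[k] C) := by
  induction z with
  | zero => simp
  | add s t hs ht => simp only [map_add, add_mul, mul_add, hs, ht]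
  | tmul x e =>
    rw [LinearMap.rTensor_tmul, assoc_tmul_eq_leg, hα, map_mul, mul_assoc, leg₁₂_commute,
      map_mul, ← mul_assoc, mul_assoc (leg₁₂ k X C E V)]
    simp

/-- The flip moves the new `E`-leg to the third place, where `W₁₃` commutes with the second leg; the
result is conjugation of `z₁₂` by `W₁₃`. -/
theorem lTensor_comm_assoc_rTensor_inner {β : X →ₗ[k] X ⊗[k] E} {W : (X ⊗[k] E)ˣ}
    (hβ : ∀ x, β x = (W : X ⊗[k] E) * x ⊗ₜ 1 * ((W⁻¹ : (X ⊗[k] E)ˣ) : X ⊗[k] E))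
    (z : X ⊗[k] C) :
    (TensorProduct.comm k E C).toLinearMap.lTensor X
      (TensorProduct.assoc k X E C (β.rTensor _ z)) =
      leg₁₃ k X C E W * leg₁₂ k X C E z * leg₁₃ k X C E ((W⁻¹ : (X ⊗[k] E)ˣ) : X ⊗[k] E) := by
  induction z with
  | zero => simp
  | add s t hs ht => simp only [map_add, add_mul, mul_add, hs, ht]
  | tmul x c =>
    rw [LinearMap.rTensor_tmul, lTensor_comm_assoc_tmul_eq_leg, hβ, map_mul, mul_assoc,
      leg₁₃_commute, map_mul, ← mul_assoc, mul_assoc (leg₁₃ k X C E W)]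
    simp

theorem lTensor_Ad_symm (U : (C ⊗[k] E)ˣ) (z : X ⊗[k] (C ⊗[k] E)) :
    (Ad k U).symm.toLinearMap.lTensor X z =
      leg₂₃ k X C E ((U⁻¹ : (C ⊗[k] E)ˣ) : C ⊗[k] E) * z * leg₂₃ k X C E U := by
  induction z with
  | zero => simp
  | add s t hs ht => simp only [map_add, add_mul, mul_add, hs, ht]
  | tmul x t => simp [Ad_symm_apply]

/-- Two inner coactions whose implementing units satisfy the pentagon-type relation
`U₂₃ V₁₂ W₁₃ = W₁₃ V₁₂` commute up to `Ad(U)`. -/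
theorem compat_of_pentagon {α : X →ₗ[k] X ⊗[k] C} {β : X →ₗ[k] X ⊗[k] E}
    {U : (C ⊗[k] E)ˣ} {V : (X ⊗[k] C)ˣ} {W : (X ⊗[k] E)ˣ}
    (hα : ∀ x, α x = (V : X ⊗[k] C) * x ⊗ₜ 1 * ((V⁻¹ : (X ⊗[k] C)ˣ) : X ⊗[k] C))
    (hβ : ∀ x, β x = (W : X ⊗[k] E) * x ⊗ₜ 1 * ((W⁻¹ : (X ⊗[k] E)ˣ) : X ⊗[k] E))
    (h : leg₂₃ k X C E U * leg₁₂ k X C E V * leg₁₃ k X C E W =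
      leg₁₃ k X C E W * leg₁₂ k X C E V) (x : X) :
    TensorProduct.assoc k X C E (α.rTensor _ (β x)) =
      (Ad k U).symm.toLinearMap.lTensor X ((TensorProduct.comm k E C).toLinearMap.lTensor X
        (TensorProduct.assoc k X E C (β.rTensor C (α x)))) := by
  rw [assoc_rTensor_inner hα, lTensor_comm_assoc_rTensor_inner hβ, lTensor_Ad_symm, hα, hβ]
  let R := X ⊗[k] (C ⊗[k] E)
  let y : R := x ⊗ₜ 1
  let u : Rˣ := Units.map (leg₂₃ k X C E : _ →* _) U
  let v : Rˣ := Units.map (leg₁₂ k X C E : _ →* _) V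
  let w : Rˣ := Units.map (leg₁₃ k X C E : _ →* _) W
  have hu : u * v * w = w * v := Units.ext h
  -- The two sides conjugate `x ⊗ 1 ⊗ 1` by `v w` and by `u⁻¹ w v`. These units are equal by the
  -- pentagon, and `hr` is the same equality inverted.
  have hl : v * w = u⁻¹ * (w * v) := by rw [← hu]; group
  have hr : w⁻¹ * v⁻¹ = v⁻¹ * w⁻¹ * u := by rw [← mul_inv_rev, hl]; group
  have hl' : (v : R) * w = (u⁻¹ : Rˣ) * (w * v) := congrArg Units.val hl
  have hr' : ((w⁻¹ : Rˣ) : R) * (v⁻¹ : Rˣ) = (v⁻¹ : Rˣ) * (w⁻¹ : Rˣ) * u :=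
    congrArg Units.val hr
  simp only [map_mul]
  change (v : R) * (w * y * (w⁻¹ : Rˣ)) * (v⁻¹ : Rˣ) =
    (u⁻¹ : Rˣ) * (w * (v * y * (v⁻¹ : Rˣ)) * (w⁻¹ : Rˣ)) * u
  calc _ = ((v : R) * w) * y * ((w⁻¹ : Rˣ) * (v⁻¹ : Rˣ)) := by simp only [mul_assoc]
    _ = _ := by rw [hl', hr']; simp only [mul_assoc]

theorem lTensor_contract_mul {ι : Type*} (s : Finset ι) (f : E →ₗ[k] k) (u v : ι → E →ₗ[k] k)
    (h : ∀ m n, f (m * n) = ∑ i ∈ s, u i m * v i n) (x y : X ⊗[k] (C ⊗[k] E)) :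
    (contract f).lTensor X (x * y) =
      ∑ i ∈ s, (contract (u i)).lTensor X x * (contract (v i)).lTensor X y := by
  induction x with
  | zero => simp
  | add x x' hx hx' => simp only [add_mul, map_add, hx, hx', Finset.sum_add_distrib]
  | tmul a m =>
    induction y with
    | zero => simp
    | add x x' hx hx' => simp only [mul_add, map_add, hx, hx', Finset.sum_add_distrib]
    | tmul b n =>
      simp [Algebra.TensorProduct.tmul_mul_tmul, contract_mul s f u v h, TensorProduct.tmul_sum]

theorem lTensor_contract_mul_leg₁₂ (f : E →ₗ[k] k) (x : X ⊗[k] (C ⊗[k] E)) (s : X ⊗[k] C) :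
    (contract f).lTensor X (x * leg₁₂ k X C E s) = (contract f).lTensor X x * s := by
  induction s with
  | zero => simp
  | add s t hs ht => simp only [map_add, mul_add, hs, ht]
  | tmul b c =>
    induction x with
    | zero => simp
    | add s t hs ht => simp only [map_add, add_mul, hs, ht]
    | tmul a m => simp [contract_mul_tmul_one]

theorem lTensor_contract_leg₁₃ (f : E →ₗ[k] k) (s : X ⊗[k] E) :
    (contract f).lTensor X (leg₁₃ k X C E s) = contract f s ⊗ₜ 1 := by
  induction s with
  | zero => simp
  | add s t hs ht => simp only [map_add, TensorProduct.add_tmul, hs, ht]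
  | tmul b c => simp [TensorProduct.smul_tmul']

theorem lTensor_contract_leg₂₃ (f : E →ₗ[k] k) (t : C ⊗[k] E) :
    (contract f).lTensor X (leg₂₃ k X C E t) = 1 ⊗ₜ contract f t := rfl

theorem contract_lTensor_contract {X C E : Type*} [AddCommGroup X] [Module k X] [AddCommGroup C]
    [Module k C] [AddCommGroup E] [Module k E] (f : C →ₗ[k] k) (g : E →ₗ[k] k)
    (z : X ⊗[k] (C ⊗[k] E)) :
    contract f ((contract g).lTensor X z) = contract (tensorFunctional f g) z := by
  rw [contract_lTensor]
  congr 1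
  ext c θ
  simp [mul_comm]

/-- Permits testing the third leg first, which leaves an identity in `X ⊗ C` that can be simplified
before the second leg is tested. -/
theorem lTensor_contract_ext {X C E : Type*} [AddCommGroup X] [Module k X] [AddCommGroup C]
    [Module k C] [AddCommGroup E] [Module k E] [FiniteDimensional k C] [FiniteDimensional k E]
    {x y : X ⊗[k] (C ⊗[k] E)}
    (h : ∀ f : E →ₗ[k] k, (contract f).lTensor X x = (contract f).lTensor X y) : x = y := by
  refine contract_tensorFunctional_ext fun f g => ?_
  rw [← contract_lTensor_contract, ← contract_lTensor_contract, h]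

end Legs

/-! ### The pentagon relation in the Heisenberg algebra -/

namespace Heisenberg
variable {k H : Type*} [Field k] [Ring H] [HopfAlgebra k H] [FiniteDimensional k H]

/-- Slicing the third leg by `h` leaves `(1 ⊗ h₍₁₎ᵒᵖ) 𝕍 (h₍₂₎ ⊗ 1) = (h ⊗ 1) 𝕍`. Slicing the second
by `ω` turns this into `(h₍₁₎ ▶ ω) h₍₂₎ = h ω`. -/
theorem pentagon : leg₂₃ k (Heisenberg k H) Hᵐᵒᵖ (HopfDual k H) (unitUop k H) *
      leg₁₂ k _ _ _ (unitV k H) * leg₁₃ k _ _ _ (unitUH k H) =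
    leg₁₃ k _ _ _ (unitUH k H : Heisenberg k H ⊗[k] HopfDual k H) *
      leg₁₂ k _ _ _ (unitV k H) := by
  refine lTensor_contract_ext fun g => ?_
  obtain ⟨h, rfl⟩ := pairing_surjective g
  rw [lTensor_contract_mul (ℛ k h).index _ (fun i => pairing k H ((ℛ k h).left i))
    (fun i => pairing k H ((ℛ k h).right i)) (pairing_mul (ℛ k h))]
  simp only [lTensor_contract_mul_leg₁₂, lTensor_contract_leg₁₃, lTensor_contract_leg₂₃,
    contract_unitUH]
  refine contract_ext fun f => ?_
  obtain ⟨ω, rfl⟩ := opFunctional_surjective f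
  rw [map_sum, contract_tmul_one_mul, contract_unitV, incl₂_mul_incl₁ (ℛ k h)]
  refine Finset.sum_congr rfl fun i _ => ?_
  rw [contract_mul_tmul_one, contract_one_tmul_mul, ← evR_eq_contract, evR_unitUop,
    ← contract_unitV]
  rfl

variable (k H) in
theorem isYetterDrinfeldRR : IsYetterDrinfeldRR (alpha k H) (beta k H) where
  isRightCoaction_left := isRightCoaction_alpha
  isRightCoaction_right := isRightCoaction_beta
  compat := compat_of_pentagon (α := (alpha k H).toLinearMap) (β := (beta k H).toLinearMap)
    alpha_apply beta_apply pentagon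

end Heisenberg

/-! ### Duality between the double `𝒟(H)` and the codouble `𝒯(H)` -/

section DoublePairing
variable {k H : Type*} [Field k] [Ring H] [HopfAlgebra k H] [FiniteDimensional k H]

theorem tensorFunctional_apply_contract {M N : Type*} [AddCommGroup M] [Module k M]
    [AddCommGroup N] [Module k N] (f : M →ₗ[k] k) (g : N →ₗ[k] k) (t : M ⊗[k] N) :
    tensorFunctional f g t = f (contract g t) := by
  induction t with
  | zero => simp
  | add z w hz hw => simp only [map_add, hz, hw]
  | tmul a b => simp [mul_comm]

instance Codouble.finite : FiniteDimensional k (Codouble k H) :=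
  inferInstanceAs (FiniteDimensional k (Hᵐᵒᵖ ⊗[k] HopfDual k H))

theorem DrinfeldDouble.induction_on {p : DrinfeldDouble k H → Prop} (d : DrinfeldDouble k H)
    (zero : p 0) (add : ∀ x y, p x → p y → p (x + y))
    (bowtie : ∀ ω h, p (DrinfeldDouble.bowtie k H ω h)) : p d :=
  TensorProduct.induction_on (motive := p) d zero bowtie add

theorem doublePairing_bowtie (ω : HopfDual k H) (h : H) :
    doublePairing k H (DrinfeldDouble.bowtie k H ω h) =
      tensorFunctional (opFunctional ω) (pairing k H h) ∘ₗ
        (Codouble.equiv k H).symm.toLinearMap := by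
  refine LinearMap.ext fun t => ?_
  obtain ⟨t, rfl⟩ := (Codouble.equiv k H).surjective t
  induction t with
  | zero => simp
  | add z w hz hw => simp only [map_add, hz, hw]
  | tmul c φ => exact doublePairing_apply ω φ h c.unop

theorem doublePairing_one : doublePairing k H 1 = counit (R := k) :=
  doublePairing_bowtie 1 1

theorem doublePairing_surjective : Function.Surjective (doublePairing k H) := by
  rw [← LinearMap.flip_injective_iff₂, injective_iff_map_eq_zero]
  intro t ht
  obtain ⟨t, rfl⟩ := (Codouble.equiv k H).surjective t
  suffices t = 0 by rw [this, map_zero]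
  refine evR_ext fun a => ?_
  rw [map_zero]
  apply MulOpposite.unop_injective
  refine (Module.forall_dual_apply_eq_zero_iff k _).mp fun f => ?_
  -- An element `t` orthogonal to all `f ⋈ a` has every slice by `a` killed by every functional `f`,
  -- hence vanishes.
  have := LinearMap.congr_fun ht (DrinfeldDouble.bowtie k H ((HopfDual.equiv k H).symm f) a)
  rw [LinearMap.flip_apply, doublePairing_bowtie] at this
  exact (tensorFunctional_apply_contract _ _ t).symm.trans this

/-- `Ad(°U)` on the codouble is dual to the twist map of the double. -/
theorem doublePairing_doubleTwist (a : H) (θ : HopfDual k H) :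
    doublePairing k H (DrinfeldDouble.equiv k H (doubleTwist k H (a ⊗ₜ θ))) ∘ₗ
        (Codouble.equiv k H).toLinearMap =
      tensorFunctional (opFunctional θ) (pairing k H a) ∘ₗ
        (Ad k (unitUop k H)).toLinearMap := by
  refine TensorProduct.ext' fun c φ => ?_
  simp only [LinearMap.comp_apply, AlgEquiv.toLinearMap_apply, tensorFunctional_apply_contract]
  -- Slicing the three factors of `°U (c ⊗ φ) °U⁻¹` by `a` gives `a₍₁₎ᵒᵖ`, `φ(a₍₂₎) c` and
  -- `S⁻¹(a₍₃₎)ᵒᵖ`. Moving the outer two onto `θ` produces `a₍₁₎ ▶ θ ◀ S⁻¹(a₍₃₎)`.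
  rw [Ad_apply, mul_assoc, ← evR_eq_contract, evR_mul _ _ (ℛ k a),
    doubleTwist_tmul (ℛ k a) fun i => ℛ k ((ℛ k a).right i)]
  simp only [map_sum, LinearMap.sum_apply, evR_mul _ _ (ℛ k ((ℛ k a).right _)), evR_unitUop,
    evR_unitUop_inv, Finset.mul_sum, evR_tmul]
  refine Finset.sum_congr rfl fun i _ => Finset.sum_congr rfl fun j _ => ?_
  rw [opFunctional_mul_left, opFunctional_mul_right, map_smul, smul_eq_mul, mul_comm]
  exact doublePairing_apply _ φ _ c.unop

/-- Only the two inner factors meet `f`. The flip hands its `C`-output to the first functional and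
its `B`-output to the second, which is why `r` and `q` are interchanged. -/
theorem Codouble.middle_tmul {A B C D : Type*} [AddCommGroup A] [Module k A] [AddCommGroup B]
    [Module k B] [AddCommGroup C] [Module k C] [AddCommGroup D] [Module k D]
    (f : B ⊗[k] C →ₗ[k] B ⊗[k] C) (p : A →ₗ[k] k) (q : C →ₗ[k] k) (r : B →ₗ[k] k)
    (s : D →ₗ[k] k) (a : A) (b : B) (c : C) (d : D) :
    tensorFunctional (tensorFunctional p q) (tensorFunctional r s)
      (TensorProduct.tensorTensorTensorComm k A B C D
        (Codouble.middle f ((a ⊗ₜ b) ⊗ₜ (c ⊗ₜ d)))) =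
      p a * tensorFunctional r q (f (b ⊗ₜ c)) * s d := by
  simp only [Codouble.middle, LinearMap.comp_apply, LinearEquiv.coe_coe,
    TensorProduct.assoc_tmul, LinearMap.lTensor_tmul, TensorProduct.assoc_symm_tmul,
    LinearMap.rTensor_tmul]
  induction f (b ⊗ₜ[k] c) with
  | zero => simp
  | add x y hx hy =>
    simp only [TensorProduct.add_tmul, TensorProduct.tmul_add, map_add, hx, hy, mul_add, add_mul]
  | tmul x y => simp; ring

theorem DrinfeldDouble.bowtie_mul_bowtie_eq (ω θ : HopfDual k H) (a b : H) :
    bowtie k H ω a * bowtie k H θ b = equiv k H ((LinearMap.mulLeft k ω).rTensor H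
      ((LinearMap.mulRight k b).lTensor _ (doubleTwist k H (a ⊗ₜ θ)))) :=
  congrArg (equiv k H) (twistedMul_tmul _ _ _ _ _)

/-- `𝒟(H)` carries only `One` and `Mul`, so the bilinearity of its product is recorded here for the
inductions on `ω ⋈ h`. -/
theorem DrinfeldDouble.add_mul (x y z : DrinfeldDouble k H) : (x + y) * z = x * z + y * z :=
  LinearMap.map_add₂ (twistedMul (doubleTwist k H)) x y z

theorem DrinfeldDouble.mul_add (x y z : DrinfeldDouble k H) : x * (y + z) = x * y + x * z :=
  map_add (twistedMul (doubleTwist k H) x) y z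

theorem DrinfeldDouble.zero_mul (x : DrinfeldDouble k H) : 0 * x = 0 :=
  LinearMap.map_zero₂ (twistedMul (doubleTwist k H)) x

theorem DrinfeldDouble.mul_zero (x : DrinfeldDouble k H) : x * 0 = 0 :=
  map_zero (twistedMul (doubleTwist k H) x)

theorem tensorFunctional_add_left {M N : Type*} [AddCommGroup M] [Module k M]
    [AddCommGroup N] [Module k N] (f f' : M →ₗ[k] k) (g : N →ₗ[k] k) :
    tensorFunctional (f + f') g = tensorFunctional f g + tensorFunctional f' g := by
  ext; simp [_root_.add_mul]

theorem tensorFunctional_add_right {M N : Type*} [AddCommGroup M] [Module k M]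
    [AddCommGroup N] [Module k N] (f : M →ₗ[k] k) (g g' : N →ₗ[k] k) :
    tensorFunctional f (g + g') = tensorFunctional f g + tensorFunctional f g' := by
  ext; simp [_root_.mul_add]

theorem tensorFunctional_zero_left {M N : Type*} [AddCommGroup M] [Module k M]
    [AddCommGroup N] [Module k N] (g : N →ₗ[k] k) :
    tensorFunctional (0 : M →ₗ[k] k) g = 0 := by
  ext; simp

theorem tensorFunctional_zero_right {M N : Type*} [AddCommGroup M] [Module k M]
    [AddCommGroup N] [Module k N] (f : M →ₗ[k] k) :
    tensorFunctional f (0 : N →ₗ[k] k) = 0 := by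
  ext; simp

/-- Multiplication by `ω` and by `b` is absorbed by the outer legs `c₍₁₎` and `φ₍₂₎`. The inner legs
`c₍₂₎ ⊗ φ₍₁₎`, on which the coproduct of `𝒯(H)` applies `Ad(°U)`, are left to pair with `z`. -/
theorem doublePairing_mul_aux (ω : HopfDual k H) (b : H) (z : HopfDual k H ⊗[k] H)
    (c : Hᵐᵒᵖ) (φ : HopfDual k H) :
    doublePairing k H (DrinfeldDouble.equiv k H ((LinearMap.mulLeft k ω).rTensor H
      ((LinearMap.mulRight k b).lTensor _ z))) (Codouble.equiv k H (c ⊗ₜ φ)) =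
      ∑ i ∈ (ℛ k c).index, ∑ j ∈ (ℛ k φ).index, opFunctional ω ((ℛ k c).left i) *
        doublePairing k H (DrinfeldDouble.equiv k H z)
          (Codouble.equiv k H ((ℛ k c).right i ⊗ₜ (ℛ k φ).left j)) *
        pairing k H b ((ℛ k φ).right j) := by
  induction z with
  | zero => simp
  | add x y hx hy =>
    simp only [map_add, LinearMap.add_apply, hx, hy, mul_add, add_mul, Finset.sum_add_distrib]
  | tmul η y =>
    have hb : ∀ (η : HopfDual k H) (y : H) (c : Hᵐᵒᵖ) (φ : HopfDual k H),
        doublePairing k H (DrinfeldDouble.equiv k H (η ⊗ₜ y)) (Codouble.equiv k H (c ⊗ₜ φ)) =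
          opFunctional η c * pairing k H y φ := fun η y c φ => doublePairing_apply η φ y c.unop
    simp only [LinearMap.rTensor_tmul, LinearMap.lTensor_tmul, LinearMap.mulLeft_apply,
      LinearMap.mulRight_apply, hb, opFunctional_mul, pairing_mul_left (ℛ k φ)]
    rw [LinearMap.comp_apply, ← (ℛ k c).eq]
    simp only [map_sum, tensorFunctional_tmul, Finset.sum_mul_sum]
    refine Finset.sum_congr rfl fun i _ => Finset.sum_congr rfl fun j _ => by ring

/-- The product of `𝒟(H)` is dual to the coproduct of `𝒯(H)`. -/
theorem doublePairing_mul (d e : DrinfeldDouble k H) : doublePairing k H (d * e) =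
    tensorFunctional (doublePairing k H d) (doublePairing k H e) ∘ₗ comul (R := k) := by
  induction d using DrinfeldDouble.induction_on with
  | zero =>
    rw [DrinfeldDouble.zero_mul, map_zero, tensorFunctional_zero_left, LinearMap.zero_comp]
  | add x y hx hy =>
    rw [DrinfeldDouble.add_mul, map_add, map_add, hx, hy, tensorFunctional_add_left,
      LinearMap.add_comp]
  | bowtie ω a =>
    induction e using DrinfeldDouble.induction_on with
    | zero =>
      rw [DrinfeldDouble.mul_zero, map_zero, tensorFunctional_zero_right, LinearMap.zero_comp]
    | add x y hx hy =>
      rw [DrinfeldDouble.mul_add, map_add, map_add, hx, hy, tensorFunctional_add_right,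
        LinearMap.add_comp]
    | bowtie θ b =>
      refine LinearMap.ext fun t => ?_
      obtain ⟨t, rfl⟩ := (Codouble.equiv k H).surjective t
      induction t with
      | zero => simp
      | add z w hz hw => simp only [map_add, hz, hw]
      | tmul c φ =>
        rw [DrinfeldDouble.bowtie_mul_bowtie_eq, doublePairing_mul_aux, doublePairing_bowtie,
          doublePairing_bowtie]
        have hk : ∀ t, doublePairing k H (DrinfeldDouble.equiv k H
            (doubleTwist k H (a ⊗ₜ θ))) (Codouble.equiv k H t) =
              tensorFunctional (opFunctional θ) (pairing k H a) (Ad k (unitUop k H) t) :=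
          LinearMap.congr_fun (doublePairing_doubleTwist a θ)
        -- This only removes the identification of `𝒯(H)` with `Hᵒᵖ ⊗ Ĥ`.
        have hc : ∀ s : (Hᵐᵒᵖ ⊗[k] HopfDual k H) ⊗[k] (Hᵐᵒᵖ ⊗[k] HopfDual k H),
            tensorFunctional
              (tensorFunctional (opFunctional ω) (pairing k H a) ∘ₗ
                (Codouble.equiv k H).symm.toLinearMap)
              (tensorFunctional (opFunctional θ) (pairing k H b) ∘ₗ
                (Codouble.equiv k H).symm.toLinearMap)
              (TensorProduct.map (Codouble.equiv k H).toLinearMap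
                (Codouble.equiv k H).toLinearMap s) =
            tensorFunctional (tensorFunctional (opFunctional ω) (pairing k H a))
              (tensorFunctional (opFunctional θ) (pairing k H b)) s := by
          intro s
          induction s with
          | zero => simp
          | add z w hz hw => simp only [map_add, hz, hw]
          | tmul x y => rfl
        refine Eq.trans ?_ (hc _).symm
        change _ = tensorFunctional _ _ (TensorProduct.tensorTensorTensorComm k _ _ _ _
          (Codouble.middle _ (comul (R := k) c ⊗ₜ[k] comul (R := k) φ)))
        conv_rhs => rw [← (ℛ k c).eq, ← (ℛ k φ).eq]
        simp only [TensorProduct.sum_tmul, TensorProduct.tmul_sum, map_sum, Codouble.middle_tmul]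
        simp only [hk]
        exact Finset.sum_comm

theorem DrinfeldDouble.comul_bowtie {ι κ : Type*} {ω : HopfDual k H} {h : H}
    (r : Coalgebra.Repr k ω ι) (s : Coalgebra.Repr k h κ) :
    comul (R := k) (bowtie k H ω h) = ∑ i ∈ r.index ×ˢ s.index,
      bowtie k H (r.right i.1) (s.left i.2) ⊗ₜ[k] bowtie k H (r.left i.1) (s.right i.2) := by
  change TensorProduct.map _ _ (TensorProduct.tensorTensorTensorComm k _ _ _ _
    (TensorProduct.comm k _ _ (comul (R := k) ω) ⊗ₜ[k] comul (R := k) h)) = _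
  rw [← r.eq, ← s.eq]
  simp only [TensorProduct.sum_tmul, TensorProduct.tmul_sum, map_sum, TensorProduct.comm_tmul,
    TensorProduct.tensorTensorTensorComm_tmul, TensorProduct.map_tmul, Finset.sum_product]
  exact Finset.sum_comm

/-- The coproduct of `𝒟(H)` is dual to the product of `𝒯(H)`. -/
theorem doublePairing_bowtie_mul {ι κ : Type*} {ω : HopfDual k H} {h : H}
    (r : Coalgebra.Repr k ω ι) (s : Coalgebra.Repr k h κ) (x y : Codouble k H) :
    doublePairing k H (DrinfeldDouble.bowtie k H ω h) (x * y) = ∑ i ∈ r.index ×ˢ s.index,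
      doublePairing k H (DrinfeldDouble.bowtie k H (r.right i.1) (s.left i.2)) x *
        doublePairing k H (DrinfeldDouble.bowtie k H (r.left i.1) (s.right i.2)) y := by
  obtain ⟨x, rfl⟩ := (Codouble.equiv k H).surjective x
  obtain ⟨y, rfl⟩ := (Codouble.equiv k H).surjective y
  rw [← map_mul]
  simp only [doublePairing_bowtie, LinearMap.comp_apply, AlgEquiv.toLinearMap_apply,
    AlgEquiv.symm_apply_apply, tensorFunctional_apply_contract]
  rw [contract_mul s.index _ (fun i => pairing k H (s.left i))
    (fun i => pairing k H (s.right i)) (pairing_mul s), map_sum]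
  simp only [opFunctional_mul_apply r, Finset.sum_product]
  exact Finset.sum_comm

end DoublePairing

/-! ### From Yetter–Drinfeld algebras to coactions of the codouble -/

section DoubleAction
variable {k H : Type*} [Field k] [Ring H] [HopfAlgebra k H] [FiniteDimensional k H]
  {X : Type*} [Ring X] [Algebra k X]

theorem inducedAction_apply (γ : X →ₐ[k] X ⊗[k] Codouble k H) (d : DrinfeldDouble k H) (x : X) :
    inducedAction γ d x = contract (doublePairing k H d) (γ x) := rfl

theorem codoubleCoaction_apply (α : X →ₐ[k] X ⊗[k] Hᵐᵒᵖ) (β : X →ₐ[k] X ⊗[k] HopfDual k H)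
    (x : X) : codoubleCoaction α β x =
      (Codouble.equiv k H).toLinearMap.lTensor X (compCoaction α β x) := rfl

theorem inducedAction_bowtie (α : X →ₐ[k] X ⊗[k] Hᵐᵒᵖ) (β : X →ₐ[k] X ⊗[k] HopfDual k H)
    (ω : HopfDual k H) (h : H) (x : X) :
    inducedAction (codoubleCoaction α β) (DrinfeldDouble.bowtie k H ω h) x =
      contract (opFunctional ω) (α (contract (pairing k H h) (β x))) := by
  rw [inducedAction_apply, codoubleCoaction_apply, doublePairing_bowtie, contract_lTensor]
  change contract (tensorFunctional _ _) (TensorProduct.assoc k X Hᵐᵒᵖ (HopfDual k H)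
    (α.toLinearMap.rTensor _ (β x))) = _
  rw [contract_tensorFunctional_assoc, contract_rTensor]
  rfl

/-- An action dual to a right coaction of `𝒯(H)` is a left action of `𝒟(H)`. -/
theorem IsRightCoaction.isLeftAction {γ : X →ₐ[k] X ⊗[k] Codouble k H}
    (hγ : IsRightCoaction γ) : IsLeftAction (inducedAction γ) := by
  obtain ⟨h1, h2⟩ := (isRightCoaction_iff (doublePairing k H) doublePairing_surjective
    doublePairing_one doublePairing_mul γ).mp hγ
  refine ⟨h1, h2, fun d => ?_, fun d x y => ?_⟩
  · rw [inducedAction_apply, map_one, Algebra.TensorProduct.one_def, contract_tmul]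
    congr 1
    -- What remains is that pairing `d` with the unit of `𝒯(H)` gives its counit.
    induction d using DrinfeldDouble.induction_on with
    | zero => simp
    | add x y hx hy => simp only [map_add, LinearMap.add_apply, hx, hy]
    | bowtie ω h => exact (doublePairing_apply ω 1 h 1)
  · induction d using DrinfeldDouble.induction_on with
    | zero => simp
    | add d e hd he => simp only [map_add, LinearMap.add_apply, hd, he]
    | bowtie ω h =>
      rw [inducedAction_apply, map_mul, contract_mul _ _ _ _
        (doublePairing_bowtie_mul (ℛ k ω) (ℛ k h)), DrinfeldDouble.comul_bowtie (ℛ k ω) (ℛ k h)]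
      simp only [map_sum, TensorProduct.map_tmul, LinearMap.mul'_apply, LinearMap.flip_apply,
        inducedAction_apply]

variable {α : X →ₐ[k] X ⊗[k] Hᵐᵒᵖ} {β : X →ₐ[k] X ⊗[k] HopfDual k H}

/-- The exchange relation `a ▷ (θ ▷ x) = (a₍₁₎ ▶ θ ◀ S⁻¹(a₍₃₎)) ▷ (a₍₂₎ ▷ x)`. -/
theorem IsYetterDrinfeldRR.exchange (h : IsYetterDrinfeldRR α β) (a : H) (θ : HopfDual k H)
    (x : X) : inducedAction (codoubleCoaction α β)
        (DrinfeldDouble.equiv k H (doubleTwist k H (a ⊗ₜ θ))) x =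
      contract (pairing k H a) (β (contract (opFunctional θ) (α x))) := by
  rw [inducedAction_apply, codoubleCoaction_apply, contract_lTensor, doublePairing_doubleTwist,
    ← contract_lTensor, h.compat, ← LinearMap.comp_apply (LinearMap.lTensor X _),
    ← LinearMap.lTensor_comp]
  -- The factor `Ad(°U)` from the twist cancels the `Ad(°U)⁻¹` of the compatibility condition, and
  -- `h2` absorbs the flip. The remaining slice of `(β ⊗ id) α` acts by `θ` and then by `a`.
  have h1 : (Ad k (unitUop k H)).toLinearMap ∘ₗ (Ad k (unitUop k H)).symm.toLinearMap =
      LinearMap.id := LinearMap.ext fun t => (Ad k (unitUop k H)).apply_symm_apply t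
  have h2 : tensorFunctional (opFunctional θ) (pairing k H a) ∘ₗ
      (TensorProduct.comm k (HopfDual k H) Hᵐᵒᵖ).toLinearMap =
        tensorFunctional (pairing k H a) (opFunctional θ) :=
    TensorProduct.ext' fun φ c => mul_comm _ _
  rw [h1, LinearMap.lTensor_id, LinearMap.id_apply, contract_lTensor, h2,
    contract_tensorFunctional_assoc, contract_rTensor]
  rfl

/-- A Yetter--Drinfeld algebra carries a coaction of the Drinfeld codouble. -/
theorem IsYetterDrinfeldRR.isRightCoaction (h : IsYetterDrinfeldRR α β) :
    IsRightCoaction (codoubleCoaction α β) := by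
  obtain ⟨hα1, hα⟩ := (isRightCoaction_iff (opFunctional : HopfDual k H →ₗ[k] Hᵐᵒᵖ →ₗ[k] k)
    opFunctional_surjective opFunctional_one opFunctional_mul _).mp h.isRightCoaction_left
  obtain ⟨hβ1, hβ⟩ := (isRightCoaction_iff (pairing k H) pairing_surjective pairing_one_left
    pairing_mul_eq_tensorFunctional _).mp h.isRightCoaction_right
  refine (isRightCoaction_iff (doublePairing k H) doublePairing_surjective
    doublePairing_one doublePairing_mul _).mpr ⟨fun x => ?_, fun d e x => ?_⟩
  · refine (inducedAction_bowtie α β 1 1 x).trans ?_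
    rw [hβ1, hα1]
  simp only [← inducedAction_apply]
  induction d using DrinfeldDouble.induction_on with
  | zero => simp [DrinfeldDouble.zero_mul]
  | add d d' hd hd' =>
    simp only [DrinfeldDouble.add_mul, map_add, LinearMap.add_apply, hd, hd']
  | bowtie ω a =>
    induction e using DrinfeldDouble.induction_on with
    | zero => simp [DrinfeldDouble.mul_zero]
    | add d d' hd hd' =>
      simp only [DrinfeldDouble.mul_add, map_add, LinearMap.add_apply, hd, hd']
    | bowtie θ b =>
      -- Because `α` and `β` are coactions, `ω η ⋈ y b` acts as `b`, then `η ⋈ y`, then `ω`. Thus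
      -- `ω` and `b` peel off, and only the exchange of `a` with `θ` is left.
      have key : ∀ z : HopfDual k H ⊗[k] H, inducedAction (codoubleCoaction α β)
          (DrinfeldDouble.equiv k H ((LinearMap.mulLeft k ω).rTensor H
            ((LinearMap.mulRight k b).lTensor _ z))) x =
          contract (opFunctional ω) (α (inducedAction (codoubleCoaction α β)
            (DrinfeldDouble.equiv k H z) (contract (pairing k H b) (β x)))) := by
        intro z
        induction z with
        | zero => simp
        | add z w hz hw => simp only [map_add, LinearMap.add_apply, hz, hw]
        | tmul η y =>
          refine (inducedAction_bowtie α β (ω * η) (y * b) x).trans ?_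
          rw [hα, hβ]
          exact congrArg (fun t => contract (opFunctional ω) (α t))
            (inducedAction_bowtie α β η y _).symm
      rw [DrinfeldDouble.bowtie_mul_bowtie_eq, key, h.exchange, inducedAction_bowtie,
        inducedAction_bowtie]

end DoubleAction

/-! ### The explicit formula for the action -/

namespace Heisenberg
variable {k H : Type*} [Field k] [Ring H] [HopfAlgebra k H] [FiniteDimensional k H]

/-- Writing `a ▶ σ = σ₍₁₎ σ₍₂₎(a)` transfers the sum over the legs of `y` in the smash product to
the legs of `σ`, leaving `y ◀ σ₍₂₎` in the second factor. -/
theorem sum_dualRegR {ι κ : Type*} {y : H} (r : Coalgebra.Repr k y ι) {σ : HopfDual k H}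
    (s : Coalgebra.Repr k σ κ) (φ : HopfDual k H) :
    smash k H φ y * incl₁ k H σ =
      ∑ j ∈ s.index, smash k H (φ * s.left j) (dualRegR y (s.right j)) := by
  have h1 : ∀ a : H, regL a σ = ∑ j ∈ s.index, pairing k H a (s.right j) • s.left j := by
    intro a
    rw [← evR_comul, ← s.eq]
    simp
  have h2 : ∀ θ : HopfDual k H, dualRegR y θ =
      ∑ i ∈ r.index, pairing k H (r.left i) θ • r.right i := by
    intro θ
    rw [dualRegR, ← r.eq]
    simp
  rw [show incl₁ k H σ = smash k H σ 1 from rfl, smash_mul_smash φ σ 1 r]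
  simp only [h1, h2, mul_one, Finset.mul_sum, map_sum, LinearMap.sum_apply, mul_smul_comm,
    map_smul, LinearMap.smul_apply]
  exact Finset.sum_comm

/-- In `h₍₁₎ (θ # g) S(h₍₂₎)` the first factor moves past `θ`, splitting once more: `(h₍₁₎ ▶ θ) #
h₍₂₎ g S(h₍₃₎)`. -/
theorem contract_beta_smash (θ : HopfDual k H) (g h : H) {n : ℕ} (h₁ h₂ h₃ : Fin n → H)
    (hh : (comul (R := k)).lTensor H (comul (R := k) h) = ∑ j, h₁ j ⊗ₜ[k] (h₂ j ⊗ₜ[k] h₃ j)) :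
    contract (pairing k H h) (beta k H (smash k H θ g)) =
      ∑ j, smash k H (regL (h₁ j) θ) (h₂ j * g * antipode k (h₃ j)) := by
  let L : H ⊗[k] (H ⊗[k] H) →ₗ[k] Heisenberg k H := TensorProduct.lift (smash k H) ∘ₗ
    TensorProduct.map (regL.flip θ) (LinearMap.mul' k H ∘ₗ
      TensorProduct.map (LinearMap.mulRight k g) (antipode k))
  have hL : ∀ a b c, L (a ⊗ₜ (b ⊗ₜ c)) = smash k H (regL a θ) (b * g * antipode k c) :=
    fun a b c => rfl
  -- The computation splits the first leg of `Δ(h)`, while `hh` splits the second. The map `L`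
  -- carries coassociativity over to the result.
  have h1 := congrArg L ((Coalgebra.coassoc_apply (R := k) h).trans hh)
  simp only [map_sum, hL] at h1
  rw [← h1, contract_beta (ℛ k h)]
  conv_rhs => rw [← (ℛ k h).eq]
  simp only [map_sum, LinearMap.rTensor_tmul]
  refine Finset.sum_congr rfl fun i _ => ?_
  rw [show ∀ y, incl₂ k H y = smash k H 1 y from fun _ => rfl,
    smash_mul_smash 1 θ g (ℛ k ((ℛ k h).left i)), Finset.sum_mul]
  conv_rhs => rw [← (ℛ k ((ℛ k h).left i)).eq]
  simp only [TensorProduct.sum_tmul, map_sum, TensorProduct.assoc_tmul, hL]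
  refine Finset.sum_congr rfl fun j _ => ?_
  rw [one_mul, ← incl₁_mul_incl₂, mul_assoc, ← map_mul, incl₁_mul_incl₂]

/-- In `ω₍₂₎ (φ # y) Ŝ⁻¹(ω₍₁₎)` the last factor is moved past `y` by `sum_dualRegR`. As `Ŝ⁻¹`
reverses the coproduct, `Ŝ⁻¹(ω₍₂₎)` joins `φ` and `Ŝ⁻¹(ω₍₁₎)` acts on `y`. -/
theorem contract_alpha_smash (ω φ : HopfDual k H) (y : H) {m : ℕ}
    (ω₁ ω₂ ω₃ : Fin m → HopfDual k H)
    (hω : (comul (R := k)).lTensor (HopfDual k H) (comul (R := k) ω) =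
      ∑ i, ω₁ i ⊗ₜ[k] (ω₂ i ⊗ₜ[k] ω₃ i)) :
    contract (opFunctional ω) (alpha k H (smash k H φ y)) =
      ∑ i, smash k H (ω₃ i * φ * (antipodeEquiv k (HopfDual k H)).symm (ω₂ i))
        (dualRegR y ((antipodeEquiv k (HopfDual k H)).symm (ω₁ i))) := by
  let S := (antipodeEquiv k (HopfDual k H)).symm.toLinearMap
  let R : HopfDual k H →ₗ[k] H :=
    { toFun := dualRegR y
      map_add' := fun a b => by simp [dualRegR, LinearMap.rTensor_add]
      map_smul' := fun a b => by simp [dualRegR, LinearMap.rTensor_smul] }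
  let L : HopfDual k H ⊗[k] (HopfDual k H ⊗[k] HopfDual k H) →ₗ[k] Heisenberg k H :=
    TensorProduct.lift (smash k H).flip ∘ₗ TensorProduct.map (R ∘ₗ S)
      (LinearMap.mul' k _ ∘ₗ (TensorProduct.comm k _ _).toLinearMap ∘ₗ
        TensorProduct.map S (LinearMap.mulRight k φ))
  have hL : ∀ a b c, L (a ⊗ₜ (b ⊗ₜ c)) = smash k H (c * φ * (antipodeEquiv k _).symm b)
      (dualRegR y ((antipodeEquiv k _).symm a)) := fun a b c => rfl
  have h1 := congrArg L ((Coalgebra.coassoc_apply (R := k) ω).trans hω)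
  simp only [map_sum, hL] at h1
  rw [← h1, contract_alpha (ℛ k ω)]
  conv_rhs => rw [← (ℛ k ω).eq]
  simp only [map_sum, LinearMap.rTensor_tmul]
  refine Finset.sum_congr rfl fun i _ => ?_
  rw [mul_assoc, sum_dualRegR (ℛ k y) (antipodeSymmRepr (ℛ k ((ℛ k ω).left i))), Finset.mul_sum]
  conv_rhs => rw [← (ℛ k ((ℛ k ω).left i)).eq]
  simp only [TensorProduct.sum_tmul, map_sum, TensorProduct.assoc_tmul, hL]
  refine Finset.sum_congr rfl fun j _ => ?_
  rw [← incl₁_mul_incl₂, ← mul_assoc, ← map_mul, ← mul_assoc, incl₁_mul_incl₂]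
  rfl

end Heisenberg

end

end HeisenbergYD

/-- The Sweedler legs in the last clause come from arbitrary finite expansions of `(id ⊗ Δ̂)Δ̂(ω)`
and `(id ⊗ Δ)Δ(h)`, so the formula holds for every choice of representatives. -/
theorem mainTheorem11 {k H : Type*} [Field k] [Ring H] [HopfAlgebra k H]
    [FiniteDimensional k H] :
    IsYetterDrinfeldRR (Heisenberg.alpha k H) (Heisenberg.beta k H) ∧
    IsRightCoaction (Heisenberg.coaction k H) ∧
    IsLeftAction (Heisenberg.action k H) ∧
    ∀ (ω θ : HopfDual k H) (h g : H) (m n : ℕ) (ω₁ ω₂ ω₃ : Fin m → HopfDual k H)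
      (h₁ h₂ h₃ : Fin n → H),
      (comul (R := k)).lTensor (HopfDual k H) (comul (R := k) ω) =
        ∑ i, ω₁ i ⊗ₜ[k] (ω₂ i ⊗ₜ[k] ω₃ i) →
      (comul (R := k)).lTensor H (comul (R := k) h) = ∑ j, h₁ j ⊗ₜ[k] (h₂ j ⊗ₜ[k] h₃ j) →
      Heisenberg.action k H (DrinfeldDouble.bowtie k H ω h) (Heisenberg.smash k H θ g) =
        ∑ i, ∑ j, Heisenberg.smash k H
          (ω₃ i * regL (h₁ j) θ * (antipodeEquiv k (HopfDual k H)).symm (ω₂ i))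
          (dualRegR (h₂ j * g * antipode k (h₃ j))
            ((antipodeEquiv k (HopfDual k H)).symm (ω₁ i))) := by
  have hYD := Heisenberg.isYetterDrinfeldRR k H
  refine ⟨hYD, hYD.isRightCoaction, hYD.isRightCoaction.isLeftAction, ?_⟩
  intro ω θ h g m n ω₁ ω₂ ω₃ h₁ h₂ h₃ hω hh
  -- `ω ⋈ h` acts by `h` through `β` first and by `ω` through `α` afterwards.
  refine (inducedAction_bowtie _ _ ω h _).trans ?_
  rw [Heisenberg.contract_beta_smash θ g h h₁ h₂ h₃ hh, map_sum, map_sum, Finset.sum_comm]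
  exact Finset.sum_congr rfl fun j _ => Heisenberg.contract_alpha_smash ω _ _ ω₁ ω₂ ω₃ hω
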